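/- There is an absolute constant $C>0$ such that the following holds. Let $\epsilon>0$, let $A\in\mathbb{R}^{d\times d}$ be a nonzero symmetric matrix (not necessarily positive semidefinite) with eigenvalues $\lambda_1\ge\dots\ge\lambda_d$, and let $k\ge C/\epsilon^2$ be an integer. Let $G\in\mathbb{R}^{k\times d}$ have i.i.d. $N(0,1/k)$ entries (variance $1/k$), let $S=GAG^T$ with eigenvalues $\lambda_1(S)\ge\dots\ge\lambda_k(S)$, and put $\alpha_i=\lambda_i(S)-\frac1k\operatorname{Tr}(S)$ for $1\le i\le k$. If $k\le d$, put $\alpha_i=0$ for $k<i\le d$ and let $\mu_1\ge\dots\ge\mu_d$ be $\alpha_1,\dots,\alpha_d$ sorted in decreasing order. Then, with probability at least $3/5$, $|\mu_i-\lambda_i|<\epsilon\|A\|_F$ for all $1\le i\le d$. If $k>d$, the same holds with the roles of the paddings exchanged: let $\lambda'_1\ge\dots\ge\lambda'_k$ be the list $\lambda_1,\dots,\lambda_d$ together with $k-d$ zeros, sorted in decreasing order. Then, with probability at least $3/5$, $|\alpha_i-\lambda'_i|<\epsilon\|A\|_F$ for all $1\le i\le k$. -/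

import Mathlib

open MeasureTheory ProbabilityTheory
open scoped NNReal ENNReal Matrix

/-- The eigenvalues `λ₁ ≥ … ≥ λₙ` of a real symmetric matrix, with multiplicity, in decreasing
order (indexed from `0`). -/
noncomputable def sortedEigenvalues {n : ℕ} (M : Matrix (Fin n) (Fin n) ℝ) (hM : M.IsSymm) :
    Fin n → ℝ :=
  fun i => Matrix.IsHermitian.eigenvalues₀ (A := M)
    ((Matrix.conjTranspose_eq_transpose_of_trivial M).trans hM)
    (Fin.cast (Fintype.card_fin n).symm i)

/-- The Frobenius norm. -/
noncomputable def frobeniusNorm {m n : ℕ} (A : Matrix (Fin m) (Fin n) ℝ) : ℝ :=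
  √(∑ i, ∑ j, A i j ^ 2)

/-- The law of the array of entries of a random `k × d` matrix with i.i.d. `N(0, 1/k)` entries. -/
noncomputable def gaussianSketch (k d : ℕ) : Measure (Fin k → Fin d → ℝ) :=
  Measure.pi fun _ : Fin k => Measure.pi fun _ : Fin d => gaussianReal 0 ((k : ℝ≥0)⁻¹)

/-- The bilinear sketch `G A Gᵀ` of a symmetric matrix is symmetric. -/
theorem sketch_isSymm {k d : ℕ} {A : Matrix (Fin d) (Fin d) ℝ} (hA : A.IsSymm)
    (G : Matrix (Fin k) (Fin d) ℝ) : (G * A * Gᵀ).IsSymm := by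
  simp [Matrix.IsSymm, Matrix.transpose_mul, hA.eq, Matrix.mul_assoc]

/-- `αᵢ = λᵢ(S) - Tr(S) / k` for the sketch `S = G A Gᵀ`, `i = 1, …, k`. -/
noncomputable def shiftedEigenvalues {k d : ℕ} (A : Matrix (Fin d) (Fin d) ℝ) (hA : A.IsSymm)
    (G : Matrix (Fin k) (Fin d) ℝ) : Fin k → ℝ :=
  fun i => sortedEigenvalues (G * A * Gᵀ) (sketch_isSymm hA G) i - (G * A * Gᵀ).trace / k

/-- Extend a list of `m` reals by zeros to a list of length `N` (used for `m ≤ N`). -/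
def zeroPad {m : ℕ} (N : ℕ) (v : Fin m → ℝ) : Fin N → ℝ :=
  fun i => if h : (i : ℕ) < m then v ⟨i, h⟩ else 0

/-- Rearrange a list of `N` reals in decreasing order. -/
noncomputable def sortDecreasing {N : ℕ} (v : Fin N → ℝ) : Fin N → ℝ :=
  fun i => v (Tuple.sort v i.rev)

/-- The output of the sketching algorithm for the sampled matrix `G`: the `k` shifted eigenvalues
of `G A Gᵀ`, padded with zeros to length `N`, in decreasing order. -/
noncomputable def spectrumAppx {k d : ℕ} (N : ℕ) (A : Matrix (Fin d) (Fin d) ℝ) (hA : A.IsSymm)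
    (G : Matrix (Fin k) (Fin d) ℝ) : Fin N → ℝ :=
  sortDecreasing (zeroPad N (shiftedEigenvalues A hA G))

/-- The eigenvalues of `A`, padded with zeros to length `N`, in decreasing order. For `N = d` no
zeros are added and this is the list `λ₁ ≥ … ≥ λ_d` itself. -/
noncomputable def paddedSpectrum {d : ℕ} (N : ℕ) (A : Matrix (Fin d) (Fin d) ℝ) (hA : A.IsSymm) :
    Fin N → ℝ :=
  sortDecreasing (zeroPad N (sortedEigenvalues A hA))

/-- For `N = d` the padded spectrum is the spectrum. -/
theorem paddedSpectrum_self {d : ℕ} (A : Matrix (Fin d) (Fin d) ℝ) (hA : A.IsSymm) :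
    paddedSpectrum d A hA = sortedEigenvalues A hA := by
  have hz : zeroPad d (sortedEigenvalues A hA) = sortedEigenvalues A hA := by
    funext i
    simp [zeroPad]
  have hanti : Antitone (sortedEigenvalues A hA) := fun i j hij =>
    Matrix.IsHermitian.eigenvalues₀_antitone (A := A)
      ((Matrix.conjTranspose_eq_transpose_of_trivial A).trans hA) (by simpa using hij)
  unfold paddedSpectrum
  rw [hz]
  have hmono : Monotone (sortedEigenvalues A hA ∘ (Fin.revPerm : Equiv.Perm (Fin d))) :=
    fun i j hij => hanti (by simpa using hij)
  have h := Tuple.unique_monotone (Tuple.monotone_sort (sortedEigenvalues A hA)) hmono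
  funext i
  simpa [sortDecreasing] using congrFun h i.rev

/-! Scale so that `‖A‖_F = 1`, order the eigenvalues `a i` by decreasing modulus, let `u i` be the
eigenvectors and `g i = G (u i)`. The form of `S` is `∑ a i ⟪g i, x⟫²`. It is split at modulus `1 /
√k`; at most `k` weights lie above.

Small weights. A Chernoff bound for weighted centred Gaussian squares and a union bound over a net
of `5 ^ k` unit vectors show that their part is `c ‖x‖²` up to `O(1 / √k) ‖x‖²`, where `c` is their
sum over `k`. The large weights sum to at most `√k` in modulus, so `Tr S / k = c + O(1 / √k)`:
subtracting it removes the bulk shift.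

Large weights. The same bound, with nets in the spans of initial segments, makes `g 0, …, g (n - 1)`
orthonormal up to `O(√(n / k))` for all `n ≤ k` at once, because the failure probabilities decay
geometrically in `n`. Only `O(1 / s²)` weights exceed a fixed fraction of a level `s`, so the Gram
error of that head, multiplied by `s`, is `O(1 / √k)` whatever `s` is. The weights between head and
bulk are controlled on the span of the head by Abel summation over all Gram bounds
(`middleForm_initialCombination_le`).

Hence for each `s` above a multiple of `1 / √k` there are subspaces of the right dimension on which
the shifted form is at least, or at most, about `s` (`exists_large_subspace_form_ge`,
`exists_large_subspace_form_le`). Courant–Fischer turns them into comparisons of eigenvalue counts,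
used for `A` and `-A`. Counts away from zero ignore zero padding, and they force the sorted lists to
be entrywise close. -/

/-! ### Exponential moments and tails of centred Gaussian squares -/

theorem integrable_exp_mul_sq_gaussianReal {v : ℝ≥0} (hv : v ≠ 0) {s : ℝ} (hs : 2 * s * v < 1) :
    Integrable (fun x => Real.exp (s * x ^ 2)) (gaussianReal 0 v) := by
  have hv' : (0 : ℝ) < v := by positivity
  rw [gaussianReal_of_var_ne_zero _ hv]
  rw [integrable_withDensity_iff_integrable_smul' (measurable_gaussianPDF _ _)
    (ae_of_all _ fun _ => gaussianPDF_lt_top)]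
  have hb : 0 < (2 * (v : ℝ))⁻¹ - s := by
    rw [sub_pos, ← one_div, lt_div_iff₀ (by positivity)]
    linarith
  refine ((integrable_exp_neg_mul_sq hb).const_mul (√(2 * Real.pi * v))⁻¹).congr
    (ae_of_all _ fun x => ?_)
  simp only [toReal_gaussianPDF, gaussianPDFReal, smul_eq_mul, sub_zero]
  rw [mul_assoc (√(2 * Real.pi * v))⁻¹, ← Real.exp_add]
  congr 2
  field_simp
  ring

theorem integral_exp_mul_sq_gaussianReal {v : ℝ≥0} (hv : v ≠ 0) {s : ℝ} (hs : 2 * s * v < 1) :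
    ∫ x, Real.exp (s * x ^ 2) ∂(gaussianReal 0 v) = (√(1 - 2 * s * v))⁻¹ := by
  have hv' : (0 : ℝ) < v := by positivity
  have hb : 0 < (2 * (v : ℝ))⁻¹ - s := by
    rw [sub_pos, ← one_div, lt_div_iff₀ (by positivity)]
    linarith
  rw [integral_gaussianReal_eq_integral_smul hv]
  have : ∀ x : ℝ, gaussianPDFReal 0 v x • Real.exp (s * x ^ 2)
      = (√(2 * Real.pi * v))⁻¹ * Real.exp (-((2 * (v : ℝ))⁻¹ - s) * x ^ 2) := by
    intro x
    simp only [gaussianPDFReal, smul_eq_mul, sub_zero]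
    rw [mul_assoc, ← Real.exp_add]
    congr 2
    field_simp
    ring
  simp_rw [this]
  rw [integral_const_mul, integral_gaussian, ← Real.sqrt_inv, ← Real.sqrt_inv,
    ← Real.sqrt_mul (by positivity)]
  congr 1
  have h1 : (1 : ℝ) - 2 * s * v ≠ 0 := by linarith
  have h2 : (2 * (v : ℝ))⁻¹ - s = (1 - 2 * s * v) / (2 * v) := by field_simp
  rw [h2]
  field_simp

/-- Squaring and putting `w = 2 * u` reduces this to `1 ≤ (1 - w) * exp (w + w ^ 2)` for `|w| ≤ 1 /
2`. For `w ≤ 0` the linear bound on `exp` suffices, as `(1 - w) * (1 + w + w ^ 2) = 1 - w ^ 3`; for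
`w ≥ 0` the quadratic term is needed. -/
theorem exp_neg_mul_inv_sqrt_le {u : ℝ} (hu : |u| ≤ 1 / 4) :
    Real.exp (-u) * (√(1 - 2 * u))⁻¹ ≤ Real.exp (2 * u ^ 2) := by
  obtain ⟨h1, h2⟩ := abs_le.1 hu
  have hpos : 0 < 1 - 2 * u := by linarith
  have key : Real.exp (-(2 * u) - (2 * u) ^ 2) ≤ 1 - 2 * u := by
    obtain ⟨w, rfl⟩ : ∃ w, u = w / 2 := ⟨2 * u, by ring⟩
    have h4 : Real.exp (-(2 * (w / 2)) - (2 * (w / 2)) ^ 2) = (Real.exp (w + w ^ 2))⁻¹ := by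
      rw [← Real.exp_neg]; congr 1; ring
    rw [h4, show 1 - 2 * (w / 2) = 1 - w by ring, inv_le_iff_one_le_mul₀ (Real.exp_pos _)]
    rcases le_total 0 w with hw | hw
    · have h5 := Real.quadratic_le_exp_of_nonneg (x := w + w ^ 2) (by positivity)
      refine le_trans ?_ (mul_le_mul_of_nonneg_left h5 (by linarith))
      have h6 : 0 ≤ (1 - w) * (1 + w) ^ 2 / 2 - w := by nlinarith
      nlinarith [mul_nonneg (sq_nonneg w) h6]
    · have h5 := Real.add_one_le_exp (w + w ^ 2)
      refine le_trans ?_ (mul_le_mul_of_nonneg_left h5 (by linarith))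
      nlinarith [mul_nonneg (sq_nonneg w) (neg_nonneg.2 hw)]
  rw [← div_eq_mul_inv, div_le_iff₀ (Real.sqrt_pos.2 hpos), ← div_le_iff₀' (Real.exp_pos _),
    ← Real.exp_sub]
  apply Real.le_sqrt_of_sq_le
  rw [← Real.exp_nat_mul]
  refine le_trans (le_of_eq ?_) key
  congr 1; push_cast; ring

section Chernoff

variable {Ω ι : Type*} [MeasurableSpace Ω] {P : Measure Ω} {X : ι → Ω → ℝ} {v : ℝ≥0}

theorem integrable_exp_centered_sq (hv : v ≠ 0) {Y : Ω → ℝ} (hY : AEMeasurable Y P)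
    (hlaw : P.map Y = gaussianReal 0 v) {s : ℝ} (hs : |s * v| ≤ 1 / 4) :
    Integrable (fun ω => Real.exp (s * (Y ω ^ 2 - v))) P := by
  have h1 := integrable_exp_mul_sq_gaussianReal hv (s := s) (by linarith [(abs_le.1 hs).2])
  rw [← hlaw] at h1
  refine ((h1.comp_aemeasurable hY).const_mul (Real.exp (-(s * v)))).congr
    (ae_of_all _ fun ω => ?_)
  simp only [Function.comp]
  rw [← Real.exp_add]
  congr 1
  ring

theorem integral_exp_centered_sq_le (hv : v ≠ 0) {Y : Ω → ℝ} (hY : AEMeasurable Y P)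
    (hlaw : P.map Y = gaussianReal 0 v) {s : ℝ} (hs : |s * v| ≤ 1 / 4) :
    ∫ ω, Real.exp (s * (Y ω ^ 2 - v)) ∂P ≤ Real.exp (2 * (s * v) ^ 2) := by
  have h0 : ∀ ω, Real.exp (s * (Y ω ^ 2 - v)) = Real.exp (-(s * v)) * Real.exp (s * Y ω ^ 2) := by
    intro ω
    rw [← Real.exp_add]
    congr 1
    ring
  simp_rw [h0]
  have h1 : ∫ ω, Real.exp (s * Y ω ^ 2) ∂P = (√(1 - 2 * s * v))⁻¹ := by
    rw [← integral_exp_mul_sq_gaussianReal hv (by linarith [(abs_le.1 hs).2]), ← hlaw,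
      integral_map hY (by fun_prop)]
  rw [integral_const_mul, h1, mul_assoc]
  exact exp_neg_mul_inv_sqrt_le hs

theorem measureReal_sum_centered_sq_ge_le [Fintype ι] [IsProbabilityMeasure P] (hv : v ≠ 0)
    (hX : ∀ i, Measurable (X i)) (hind : iIndepFun X P) (hlaw : ∀ i, P.map (X i) = gaussianReal 0 v)
    (b : ι → ℝ) {θ : ℝ} (hθ : 0 ≤ θ) (hb : ∀ i, |θ * b i * v| ≤ 1 / 4) (t : ℝ) :
    P.real {ω | t ≤ ∑ i, b i * (X i ω ^ 2 - v)}
      ≤ Real.exp (2 * (θ * v) ^ 2 * ∑ i, b i ^ 2 - θ * t) := by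
  set Z : ι → Ω → ℝ := fun i ω => b i * (X i ω ^ 2 - v) with hZ
  have hZind : iIndepFun Z P := hind.comp (fun i x => b i * (x ^ 2 - v)) (fun i => by fun_prop)
  have hZm : ∀ i, Measurable (Z i) := fun i => by fun_prop
  have hint : ∀ i, Integrable (fun ω => Real.exp (θ * Z i ω)) P := fun i => by
    simpa [hZ, mul_assoc] using
      integrable_exp_centered_sq hv (hX i).aemeasurable (hlaw i) (hb i)
  have hmgf : ∀ i, mgf (Z i) P θ ≤ Real.exp (2 * (θ * b i * v) ^ 2) := fun i => by
    simpa [mgf, hZ, mul_assoc] using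
      integral_exp_centered_sq_le hv (hX i).aemeasurable (hlaw i) (hb i)
  have h1 := measure_ge_le_exp_mul_mgf (μ := P) (X := ∑ i, Z i) t hθ
    (hZind.integrable_exp_mul_sum hZm fun i _ => hint i)
  rw [hZind.mgf_sum hZm] at h1
  have h2 : ∏ i, mgf (Z i) P θ ≤ Real.exp (2 * (θ * v) ^ 2 * ∑ i, b i ^ 2) := by
    refine (Finset.prod_le_prod (fun _ _ => mgf_nonneg) fun i _ => hmgf i).trans (le_of_eq ?_)
    rw [← Real.exp_sum, Finset.mul_sum]
    congr 1
    exact Finset.sum_congr rfl fun i _ => by ring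
  have h3 : {ω | t ≤ ∑ i, b i * (X i ω ^ 2 - v)} = {ω | t ≤ (∑ i, Z i) ω} := by
    ext ω; simp [hZ]
  rw [h3]
  refine h1.trans ?_
  rw [sub_eq_add_neg, add_comm, Real.exp_add, neg_mul]
  gcongr

/-- A Hanson–Wright type tail bound for a weighted sum of centred squares of independent
Gaussians. -/
theorem measureReal_abs_sum_centered_sq_ge_le [Fintype ι] [IsProbabilityMeasure P] (hv : v ≠ 0)
    (hX : ∀ i, Measurable (X i)) (hind : iIndepFun X P) (hlaw : ∀ i, P.map (X i) = gaussianReal 0 v)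
    (b : ι → ℝ) {θ : ℝ} (hθ : 0 ≤ θ) (hb : ∀ i, |θ * b i * v| ≤ 1 / 4) (t : ℝ) :
    P.real {ω | t ≤ |∑ i, b i * (X i ω ^ 2 - v)|}
      ≤ 2 * Real.exp (2 * (θ * v) ^ 2 * ∑ i, b i ^ 2 - θ * t) := by
  have h1 := measureReal_sum_centered_sq_ge_le hv hX hind hlaw b hθ hb t
  have h2 := measureReal_sum_centered_sq_ge_le hv hX hind hlaw (fun i => -b i) hθ
    (fun i => by simpa using hb i) t
  simp only [neg_mul, Finset.sum_neg_distrib, neg_sq] at h2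
  have h3 : {ω | t ≤ |∑ i, b i * (X i ω ^ 2 - v)|} ⊆ {ω | t ≤ ∑ i, b i * (X i ω ^ 2 - v)} ∪
      {ω | t ≤ -∑ i, b i * (X i ω ^ 2 - v)} := fun ω hω => by
    simpa [le_abs] using hω
  have h4 := (measureReal_mono (μ := P) h3).trans (measureReal_union_le _ _)
  linarith

/-- The tail bound for weights with `∑ bᵢ² ≤ V²` and `|bᵢ| ≤ V / √m`: deviations of size
`c V √m` have probability exponentially small in `m`. -/
theorem measureReal_abs_sum_centered_sq_ge_le_of_weights [Fintype ι] [IsProbabilityMeasure P]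
    (hv : v ≠ 0) (hX : ∀ i, Measurable (X i)) (hind : iIndepFun X P)
    (hlaw : ∀ i, P.map (X i) = gaussianReal 0 v) (b : ι → ℝ) {V m : ℝ} (hV : 0 < V) (hm : 0 ≤ m)
    (hb2 : ∑ i, b i ^ 2 ≤ V ^ 2) (hb : ∀ i, |b i| * √m ≤ V) (c : ℝ) :
    P.real {ω | c * V * √m * v ≤ |∑ i, b i * (X i ω ^ 2 - v)|}
      ≤ 2 * Real.exp ((1 / 8 - c / 4) * m) := by
  have hv' : (0 : ℝ) < v := by positivity
  -- This `θ` is the largest that the bound on `|b i|` permits: `|θ * b i * v| ≤ 1 / 4`. The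
  -- quadratic term of the exponent is then at most `m / 8` and the linear one is `c * m / 4`.
  have h := measureReal_abs_sum_centered_sq_ge_le hv hX hind hlaw b (θ := √m / (4 * V * v))
    (by positivity) (fun i => ?_) (c * V * √m * v)
  · refine h.trans ?_
    gcongr
    have h1 : √m / (4 * V * v) * (c * V * √m * v) = c / 4 * m := by
      field_simp
      rw [Real.sq_sqrt hm, mul_comm]
    have h2 : 2 * (√m / (4 * V * v) * v) ^ 2 * V ^ 2 = m / 8 := by
      field_simp
      rw [Real.sq_sqrt hm]
      ring
    have h3 : 2 * (√m / (4 * V * v) * v) ^ 2 * ∑ i, b i ^ 2 ≤ m / 8 := by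
      rw [← h2]; gcongr
    rw [h1]
    linarith
  · have h1 : √m / (4 * V * v) * b i * v = √m * b i / (4 * V) := by field_simp
    rw [h1, abs_div, abs_mul, abs_of_nonneg (Real.sqrt_nonneg m),
      abs_of_pos (show 0 < 4 * V by positivity),
      div_le_div_iff₀ (by positivity) (by norm_num)]
    linarith [hb i, mul_comm (√m) |b i|]

end Chernoff

/-! ### Orthonormal functionals of the Gaussian matrix -/

section Sketch

instance gaussianSketch_isProbabilityMeasure (k d : ℕ) :
    IsProbabilityMeasure (gaussianSketch k d) := by
  unfold gaussianSketch; infer_instance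

theorem iIndepFun_entries_gaussianSketch (k d : ℕ) :
    iIndepFun (fun (p : Fin k × Fin d) (G : Fin k → Fin d → ℝ) => G p.1 p.2)
      (gaussianSketch k d) := by
  unfold gaussianSketch
  simp only [← Measure.infinitePi_eq_pi]
  exact iIndepFun_uncurry_infinitePi'
    (μ := fun (_ : Fin k) (_ : Fin d) => gaussianReal 0 ((k : ℝ≥0)⁻¹))
    (X := fun _ _ => id) (fun _ _ => measurable_id)

theorem map_entry_gaussianSketch (k d : ℕ) (p : Fin k × Fin d) :
    (gaussianSketch k d).map (fun G => G p.1 p.2) = gaussianReal 0 ((k : ℝ≥0)⁻¹) := by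
  have h1 := (measurePreserving_eval
    (fun _ : Fin k => Measure.pi fun _ : Fin d => gaussianReal 0 ((k : ℝ≥0)⁻¹)) p.1)
  have h2 := (measurePreserving_eval (fun _ : Fin d => gaussianReal 0 ((k : ℝ≥0)⁻¹)) p.2)
  exact (h2.comp h1).map_eq

/-- Linear functionals of the sketch with orthonormal coefficient arrays are independent, with the
law of a single entry. -/
theorem orthonormal_functionals_gaussianSketch {k d : ℕ} {ι : Type*} [Fintype ι] [DecidableEq ι]
    (w : ι → Fin k × Fin d → ℝ) (hw : ∀ i j, ∑ p, w i p * w j p = if i = j then 1 else 0) :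
    iIndepFun (fun i (G : Fin k → Fin d → ℝ) => ∑ p, w i p * G p.1 p.2) (gaussianSketch k d) ∧
      ∀ i, (gaussianSketch k d).map (fun G => ∑ p, w i p * G p.1 p.2)
        = gaussianReal 0 ((k : ℝ≥0)⁻¹) := by
  set P := gaussianSketch k d with hP
  set e : Fin k × Fin d → (Fin k → Fin d → ℝ) → ℝ := fun p G => G p.1 p.2 with he
  have hem : ∀ p, Measurable (e p) := fun p => by fun_prop
  have hlaw : ∀ p, HasLaw (e p) (gaussianReal 0 ((k : ℝ≥0)⁻¹)) P := fun p =>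
    ⟨(hem p).aemeasurable, map_entry_gaussianSketch k d p⟩
  have hind : iIndepFun e P := iIndepFun_entries_gaussianSketch k d
  have hg : HasGaussianLaw (fun G p => e p G) P :=
    hind.hasGaussianLaw fun p => (hlaw p).hasGaussianLaw
  have hL2 : ∀ p, MemLp (e p) 2 P := fun p => (hlaw p).hasGaussianLaw.memLp_two
  have hcov : ∀ p q, cov[e p, e q; P] = if p = q then (k : ℝ)⁻¹ else 0 := by
    intro p q
    split_ifs with h
    · subst h
      rw [covariance_self (hem p).aemeasurable, (hlaw p).variance_eq]
      simp
    · exact (hind.indepFun h).covariance_eq_zero (hL2 p) (hL2 q)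
  set X : ι → (Fin k → Fin d → ℝ) → ℝ := fun i G => ∑ p, w i p * e p G with hX
  have hXcov : ∀ i j, cov[X i, X j; P] = if i = j then (k : ℝ)⁻¹ else 0 := by
    intro i j
    rw [hX]
    rw [covariance_fun_sum_fun_sum (fun p => (hL2 p).const_mul _) (fun p => (hL2 p).const_mul _)]
    simp_rw [covariance_const_mul_left, covariance_const_mul_right, hcov]
    simp only [mul_ite, mul_zero, Finset.sum_ite_eq, Finset.mem_univ, if_true]
    have := congrArg (· * (k : ℝ)⁻¹) (hw i j)
    simp only [Finset.sum_mul, ite_mul, one_mul, zero_mul] at this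
    rw [← this]
    exact Finset.sum_congr rfl fun p _ => by ring
  have hXm : ∀ i, Measurable (X i) := fun i => by fun_prop
  have hXg : HasGaussianLaw (fun G i => X i G) P := by
    have := hg.map_fun (F := ι → ℝ)
      (ContinuousLinearMap.pi fun i => ∑ p, w i p • ContinuousLinearMap.proj p)
    convert! this using 1
    ext G i
    simp [hX]
  refine ⟨hXg.iIndepFun_of_covariance_eq_zero fun i j hij => by rw [hXcov, if_neg hij], fun i => ?_⟩
  have hmean : P[X i] = 0 := by
    simp only [hX]
    rw [integral_finsetSum _ fun p _ => ((hL2 p).integrable (by norm_num)).const_mul _]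
    refine Finset.sum_eq_zero fun p _ => ?_
    rw [integral_const_mul, (hlaw p).integral_eq]
    simp
  rw [show (fun G : Fin k → Fin d → ℝ => ∑ p, w i p * G p.1 p.2) = X i from rfl,
    (hXg.eval i).map_eq_gaussianReal, hmean, ← covariance_self (hXm i).aemeasurable, hXcov,
    if_pos rfl]
  congr 1
  ext
  simp

end Sketch

/-! ### Nets and quadratic forms -/

section Net

variable {E : Type*} [NormedAddCommGroup E] [InnerProductSpace ℝ E]

/-- A symmetric bilinear form is bounded by its quadratic form. -/
theorem abs_bilin_le_of_abs_quad_le (B : LinearMap.BilinForm ℝ E) (hB : ∀ x y, B x y = B y x)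
    {m : ℝ} (h : ∀ x, |B x x| ≤ m * ‖x‖ ^ 2) (x y : E) : |B x y| ≤ m * (‖x‖ * ‖y‖) := by
  rcases eq_or_ne x 0 with rfl | hx
  · simp
  rcases eq_or_ne y 0 with rfl | hy
  · simp
  have hx' := norm_pos_iff.2 hx
  have hy' := norm_pos_iff.2 hy
  -- Rescaling both vectors to norm `‖x‖ * ‖y‖` lets polarization produce a product of norms instead
  -- of a sum of squares.
  have h1 := h (‖y‖ • x + ‖x‖ • y)
  have h2 := h (‖y‖ • x - ‖x‖ • y)
  have h3 := parallelogram_law_with_norm ℝ (‖y‖ • x) (‖x‖ • y)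
  simp only [norm_smul, norm_norm] at h3
  have h4 : 4 * (‖x‖ * ‖y‖) * B x y = B (‖y‖ • x + ‖x‖ • y) (‖y‖ • x + ‖x‖ • y)
      - B (‖y‖ • x - ‖x‖ • y) (‖y‖ • x - ‖x‖ • y) := by
    simp only [map_add, map_sub, map_smul, LinearMap.add_apply, LinearMap.sub_apply,
      LinearMap.smul_apply, smul_eq_mul, hB y x]
    ring
  have h5 : |4 * (‖x‖ * ‖y‖) * B x y| ≤ 4 * (‖x‖ * ‖y‖) * (m * (‖x‖ * ‖y‖)) := by
    rw [h4]
    refine (abs_sub _ _).trans ((add_le_add h1 h2).trans (le_of_eq ?_))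
    linear_combination m * h3
  rw [abs_mul, abs_of_pos (by positivity)] at h5
  exact le_of_mul_le_mul_left h5 (by positivity)

/-- A `1 / 2`-separated subset of the sphere of maximal cardinality is a net, since any uncovered
point could be added. Doubling makes it 1-separated in the ball of radius 2, where the Besicovitch
packing bound applies. -/
theorem exists_sphere_net [FiniteDimensional ℝ E] {n : ℕ} (hn : Module.finrank ℝ E ≤ n) :
    ∃ N : Finset E, (∀ x ∈ N, ‖x‖ = 1) ∧ N.card ≤ 5 ^ n ∧
      ∀ x : E, ‖x‖ = 1 → ∃ y ∈ N, ‖x - y‖ ≤ 1 / 2 := by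
  classical
  let Sep : Finset E → Prop := fun s =>
    (∀ x ∈ s, ‖x‖ = 1) ∧ ∀ x ∈ s, ∀ y ∈ s, x ≠ y → 1 / 2 ≤ ‖x - y‖
  have hcard : ∀ s, Sep s → s.card ≤ 5 ^ n := by
    intro s hs
    have hinj : Function.Injective fun x : E => (2 : ℝ) • x :=
      smul_right_injective E two_ne_zero
    have h := Besicovitch.card_le_of_separated (s.image fun x : E => (2 : ℝ) • x) ?_ ?_
    · rw [Finset.card_image_of_injective _ hinj] at h
      exact h.trans (Nat.pow_le_pow_right (by norm_num) hn)
    · intro c hc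
      obtain ⟨x, hx, rfl⟩ := Finset.mem_image.1 hc
      simp [norm_smul, hs.1 x hx]
    · intro c hc c' hc' hne
      obtain ⟨x, hx, rfl⟩ := Finset.mem_image.1 hc
      obtain ⟨y, hy, rfl⟩ := Finset.mem_image.1 hc'
      have := hs.2 x hx y hy (fun h => hne (by rw [h]))
      rw [← smul_sub, norm_smul]
      norm_num
      linarith
  let T : Set ℕ := {c | ∃ s, Sep s ∧ s.card = c}
  have hT : T.Nonempty := ⟨0, ∅, by simp [Sep], rfl⟩
  have hbd : BddAbove T := ⟨5 ^ n, by rintro c ⟨s, hs, rfl⟩; exact hcard s hs⟩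
  obtain ⟨s, hs, hsc⟩ := Nat.sSup_mem hT hbd
  refine ⟨s, hs.1, hcard s hs, fun x hx => ?_⟩
  by_contra! hcon
  have hxs : x ∉ s := fun h => by
    have := hcon x h
    norm_num at this
  have hsep : Sep (insert x s) := by
    refine ⟨fun y hy => ?_, fun y hy z hz hne => ?_⟩
    · rcases Finset.mem_insert.1 hy with rfl | hy
      · exact hx
      · exact hs.1 y hy
    · rcases Finset.mem_insert.1 hy with hy | hy <;> rcases Finset.mem_insert.1 hz with hz | hz
      · exact absurd (hy.trans hz.symm) hne
      · rw [hy]; exact (hcon z hz).le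
      · rw [hz, norm_sub_rev]; exact (hcon y hy).le
      · exact hs.2 y hy z hz hne
  have := le_csSup hbd ⟨_, hsep, rfl⟩
  rw [Finset.card_insert_of_notMem hxs, hsc] at this
  omega

/-- A quadratic form that is small on a `1/2`-net of the sphere is small everywhere. -/
theorem abs_quad_le_of_net [FiniteDimensional ℝ E] (B : LinearMap.BilinForm ℝ E)
    (hB : ∀ x y, B x y = B y x) (hcont : Continuous fun x => B x x) {N : Set E}
    (hN1 : ∀ x ∈ N, ‖x‖ = 1) (hN : ∀ x : E, ‖x‖ = 1 → ∃ y ∈ N, ‖x - y‖ ≤ 1 / 2)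
    {t : ℝ} (ht : ∀ x ∈ N, |B x x| ≤ t) (x : E) : |B x x| ≤ 32 * t * ‖x‖ ^ 2 := by
  rcases eq_or_ne x 0 with rfl | hx0
  · simp
  have hne : (Metric.sphere (0 : E) 1).Nonempty :=
    ⟨‖x‖⁻¹ • x, by simp [norm_smul, norm_ne_zero_iff.2 hx0]⟩
  obtain ⟨z, hz, hmax⟩ := (isCompact_sphere (0 : E) 1).exists_isMaxOn hne
    (hcont.abs.continuousOn)
  have hz1 : ‖z‖ = 1 := by simpa using hz
  set m := |B z z| with hm
  have hall : ∀ y, |B y y| ≤ m * ‖y‖ ^ 2 := by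
    intro y
    rcases eq_or_ne y 0 with rfl | hy0
    · simp
    have hy' := norm_pos_iff.2 hy0
    have h1 : |B (‖y‖⁻¹ • y) (‖y‖⁻¹ • y)| ≤ m :=
      hmax (by simp [norm_smul, norm_ne_zero_iff.2 hy0])
    simp only [map_smul, LinearMap.smul_apply, smul_eq_mul, abs_mul, abs_inv, abs_norm] at h1
    calc |B y y| = ‖y‖⁻¹ * (‖y‖⁻¹ * |B y y|) * ‖y‖ ^ 2 := by field_simp
      _ ≤ m * ‖y‖ ^ 2 := by gcongr
  obtain ⟨y, hy, hzy⟩ := hN z hz1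
  have hy1 := hN1 y hy
  have h1 : B z z - B y y = B (z - y) (z + y) := by
    simp only [map_add, map_sub, LinearMap.sub_apply, hB z y]
    ring
  have h2 := abs_bilin_le_of_abs_quad_le B hB hall (z - y) (z + y)
  have h3 := parallelogram_law_with_norm ℝ z y
  rw [hz1, hy1] at h3
  have hm0 : 0 ≤ m := abs_nonneg _
  -- With `r = ‖z - y‖ ^ 2 ≤ 1 / 4` the squared product is `r * (4 - r) ≤ 15 / 16 < (31 / 32) ^ 2`.
  -- The maximum `m` then satisfies `m ≤ t + 31 / 32 * m`, whence the factor 32.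
  have h4 : ‖z - y‖ * ‖z + y‖ ≤ 31 / 32 := by
    have h5 : (‖z - y‖ * ‖z + y‖) ^ 2 ≤ (31 / 32) ^ 2 := by
      have h6 : ‖z - y‖ ^ 2 ≤ 1 / 4 := by nlinarith [norm_nonneg (z - y)]
      have h7 : ‖z + y‖ ^ 2 = 4 - ‖z - y‖ ^ 2 := by linarith
      rw [mul_pow, h7]
      nlinarith [sq_nonneg ‖z - y‖]
    exact le_of_sq_le_sq h5 (by norm_num)
  have h8 : m ≤ t + m * (31 / 32) := by
    calc m = |B y y + B (z - y) (z + y)| := by rw [hm, ← h1]; congr 1; ring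
      _ ≤ |B y y| + |B (z - y) (z + y)| := abs_add_le _ _
      _ ≤ t + m * (31 / 32) := add_le_add (ht y hy) (h2.trans (by gcongr))
  refine (hall x).trans ?_
  gcongr
  linarith

end Net

/-- Uniform concentration over a subspace of dimension at most `n` of weighted sums of centred
squares of orthogonal linear functionals of the sketch. -/
theorem measureReal_sketch_form_deviation_le {E ι : Type*} [NormedAddCommGroup E]
    [InnerProductSpace ℝ E] [FiniteDimensional ℝ E] [Fintype ι] [DecidableEq ι] {k d n : ℕ}
    (hk : k ≠ 0) (hn : Module.finrank ℝ E ≤ n) (w : ι → E →ₗ[ℝ] (Fin k × Fin d → ℝ))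
    (hw : ∀ x i j, ∑ p, w i x p * w j x p = if i = j then ‖x‖ ^ 2 else 0)
    (b : ι → ℝ) {V : ℝ} (hV : 0 < V) (hb2 : ∑ i, b i ^ 2 ≤ V ^ 2) (hb : ∀ i, |b i| * √n ≤ V)
    (c : ℝ) :
    (gaussianSketch k d).real {G | ¬ ∀ x : E,
      |∑ i, b i * ((∑ p, w i x p * G p.1 p.2) ^ 2 - ‖x‖ ^ 2 / k)|
        ≤ 32 * (c * V * √n / k) * ‖x‖ ^ 2} ≤ 5 ^ n * (2 * Real.exp ((1 / 8 - c / 4) * n)) := by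
  obtain ⟨N, hN1, hNc, hN⟩ := exists_sphere_net hn
  have hsub : {G : Fin k → Fin d → ℝ | ¬ ∀ x : E,
      |∑ i, b i * ((∑ p, w i x p * G p.1 p.2) ^ 2 - ‖x‖ ^ 2 / k)|
        ≤ 32 * (c * V * √n / k) * ‖x‖ ^ 2} ⊆
      ⋃ x ∈ N, {G | c * V * √n * ((k : ℝ≥0)⁻¹ : ℝ≥0) ≤
        |∑ i, b i * ((∑ p, w i x p * G p.1 p.2) ^ 2 - ((k : ℝ≥0)⁻¹ : ℝ≥0))|} := by
    intro G hG
    by_contra hcon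
    apply hG
    simp only [Set.mem_iUnion, Set.mem_ofPred_eq, not_exists, not_le] at hcon
    let ℓ : ι → E →ₗ[ℝ] ℝ := fun i =>
      { toFun := fun x => ∑ p, w i x p * G p.1 p.2
        map_add' := fun x y => by simp [add_mul, Finset.sum_add_distrib]
        map_smul' := fun r x => by simp [Finset.mul_sum, mul_assoc] }
    have hℓ : ∀ i, Continuous (ℓ i) := fun i => (ℓ i).continuous_of_finiteDimensional
    let B : LinearMap.BilinForm ℝ E := LinearMap.mk₂ ℝ
      (fun x y => ∑ i, b i * (ℓ i x * ℓ i y - inner ℝ x y / k))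
      (fun x y z => by
        rw [← Finset.sum_add_distrib]
        exact Finset.sum_congr rfl fun i _ => by rw [map_add, inner_add_left]; ring)
      (fun r x y => by
        rw [smul_eq_mul, Finset.mul_sum]
        exact Finset.sum_congr rfl fun i _ => by
          rw [map_smul, real_inner_smul_left, smul_eq_mul]; ring)
      (fun x y z => by
        rw [← Finset.sum_add_distrib]
        exact Finset.sum_congr rfl fun i _ => by rw [map_add, inner_add_right]; ring)
      (fun r x y => by
        rw [smul_eq_mul, Finset.mul_sum]
        exact Finset.sum_congr rfl fun i _ => by
          rw [map_smul, real_inner_smul_right, smul_eq_mul]; ring)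
    have hBxx : ∀ x, B x x = ∑ i, b i * ((∑ p, w i x p * G p.1 p.2) ^ 2 - ‖x‖ ^ 2 / k) := by
      intro x
      simp only [B, LinearMap.mk₂_apply, real_inner_self_eq_norm_sq]
      exact Finset.sum_congr rfl fun i _ => by rw [sq (∑ p, _)]; rfl
    have hBs : ∀ x y, B x y = B y x := fun x y => by
      simp only [B, LinearMap.mk₂_apply]
      exact Finset.sum_congr rfl fun i _ => by rw [real_inner_comm, mul_comm (ℓ i x)]
    have hBc : Continuous fun x => B x x := by
      simp only [B, LinearMap.mk₂_apply]
      fun_prop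
    intro x
    rw [← hBxx]
    refine abs_quad_le_of_net B hBs hBc (N := N) hN1 hN (fun y hy => ?_) x
    have := (hcon y hy).le
    rw [hBxx, hN1 y hy]
    simpa [div_eq_mul_inv] using this
  refine (measureReal_mono hsub (measure_ne_top _ _)).trans ((measureReal_biUnion_finset_le _ _).trans ?_)
  refine (Finset.sum_le_card_nsmul N _ (2 * Real.exp ((1 / 8 - c / 4) * n)) fun x hx => ?_).trans ?_
  · obtain ⟨hind, hlaw⟩ := orthonormal_functionals_gaussianSketch (fun i => w i x) (fun i j => by
      rw [hw, hN1 x hx]; simp)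
    exact measureReal_abs_sum_centered_sq_ge_le_of_weights (by simpa using hk)
      (fun i => by fun_prop) hind hlaw b hV (Nat.cast_nonneg n) hb2 hb c
  · rw [nsmul_eq_mul]
    gcongr
    exact_mod_cast hNc

/-! ### Abel summation and superlevel sets -/

section Combinatorial

theorem Finset.sum_range_mul_nonneg_of_antitone {w x : ℕ → ℝ} (hw : Antitone w) (hw0 : ∀ i, 0 ≤ w i)
    {d : ℕ} (hx : ∀ m ≤ d, 0 ≤ ∑ i ∈ Finset.range m, x i) :
    0 ≤ ∑ i ∈ Finset.range d, w i * x i := by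
  suffices h : ∀ m ≤ d, w m * ∑ i ∈ Finset.range m, x i ≤ ∑ i ∈ Finset.range m, w i * x i from
    (mul_nonneg (hw0 d) (hx d le_rfl)).trans (h d le_rfl)
  intro m
  induction m with
  | zero => simp
  | succ m ih =>
    intro hm
    rw [Finset.sum_range_succ (fun i => w i * x i)]
    have h1 := ih (by omega)
    have h2 : w (m + 1) * ∑ i ∈ Finset.range (m + 1), x i
        ≤ w m * ∑ i ∈ Finset.range (m + 1), x i :=
      mul_le_mul_of_nonneg_right (hw (Nat.le_succ m)) (hx _ hm)
    rw [Finset.sum_range_succ, mul_add] at h2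
    rw [Finset.sum_range_succ]
    linarith

/-- Abel summation: a decreasing nonnegative weight preserves nonnegativity of partial sums. -/
theorem Fin.sum_mul_nonneg_of_antitone {d : ℕ} {w x : Fin d → ℝ} (hw : Antitone w)
    (hw0 : ∀ i, 0 ≤ w i) (hx : ∀ m ≤ d, 0 ≤ ∑ i with i.val < m, x i) : 0 ≤ ∑ i, w i * x i := by
  let w' : ℕ → ℝ := fun j => if h : j < d then w ⟨j, h⟩ else 0
  let x' : ℕ → ℝ := fun j => if h : j < d then x ⟨j, h⟩ else 0
  have hw'i : ∀ i : Fin d, w' i = w i := fun i => by simp [w']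
  have hx'i : ∀ i : Fin d, x' i = x i := fun i => by simp [x']
  have hw' : Antitone w' := by
    intro i j hij
    by_cases hj : j < d
    · have hi : i < d := by omega
      simp only [w', hi, hj, dif_pos]
      exact hw hij
    · by_cases hi : i < d
      · simpa [w', hi, hj] using hw0 _
      · simp [w', hi, hj]
  have hw'0 : ∀ i, 0 ≤ w' i := fun i => by
    simp only [w']; split_ifs
    · exact hw0 _
    · exact le_rfl
  have h := Finset.sum_range_mul_nonneg_of_antitone hw' hw'0 (d := d) (x := x') fun m hm => by
    have := hx m hm
    rw [Finset.sum_filter] at this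
    simp only [← hx'i] at this
    rw [Fin.sum_univ_eq_sum_range (fun j => if j < m then x' j else 0), ← Finset.sum_filter] at this
    convert this using 2
    ext j
    simp
    omega
  rw [← Fin.sum_univ_eq_sum_range (fun j => w' j * x' j)] at h
  simpa only [hw'i, hx'i] using h

/-- A superlevel set of a decreasing list is an initial segment, hence determined by its
cardinality. This converts counts into entrywise inequalities and thresholds into initial segments.
-/
theorem Fin.superlevel_eq_initial {d : ℕ} {b : Fin d → ℝ} (hb : Antitone b) (t : ℝ) (i : Fin d) :
    t ≤ b i ↔ i.val < (Finset.univ.filter fun j => t ≤ b j).card := by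
  constructor
  · intro hi
    have : Finset.Iic i ⊆ Finset.univ.filter fun j => t ≤ b j := fun j hj => by
      simpa using hi.trans (hb (Finset.mem_Iic.1 hj))
    have := Finset.card_le_card this
    rw [Fin.card_Iic] at this
    omega
  · intro hi
    by_contra hcon
    have : (Finset.univ.filter fun j => t ≤ b j) ⊆ Finset.Iio i := fun j hj => by
      rw [Finset.mem_Iio]
      by_contra hij
      exact hcon ((by simpa using hj : t ≤ b j).trans (hb (not_lt.1 hij)))
    have := Finset.card_le_card this
    rw [Fin.card_Iio] at this
    omega

theorem card_superlevel_mul_sq_le {ι : Type*} [Fintype ι] {a : ι → ℝ} (ha : ∑ i, a i ^ 2 ≤ 1) {t : ℝ}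
    (ht : 0 ≤ t) : ((Finset.univ.filter fun j => t ≤ |a j|).card : ℝ) * t ^ 2 ≤ 1 := by
  refine le_trans ?_ ha
  rw [← nsmul_eq_mul]
  refine (Finset.card_nsmul_le_sum _ (fun i => a i ^ 2) _ fun i hi => ?_).trans
    (Finset.sum_le_sum_of_subset_of_nonneg (Finset.filter_subset _ _) fun _ _ _ => sq_nonneg _)
  rw [← sq_abs (a i)]
  have : t ≤ |a i| := by simpa using hi
  gcongr

end Combinatorial

/-! ### Nearly orthonormal families -/

section Deterministic

variable {E : Type*} [NormedAddCommGroup E] [InnerProductSpace ℝ E] {d : ℕ}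

/-- The linear combination of the first `n` vectors of a family. -/
noncomputable def initialCombination (g : Fin d → E) (n : ℕ) : (Fin d → ℝ) →ₗ[ℝ] E where
  toFun y := ∑ i with i.val < n, y i • g i
  map_add' y z := by simp [add_smul, Finset.sum_add_distrib]
  map_smul' r y := by simp [Finset.smul_sum, mul_smul]

theorem initialCombination_apply (g : Fin d → E) (n : ℕ) (y : Fin d → ℝ) :
    initialCombination g n y = ∑ i with i.val < n, y i • g i := rfl

/-- The first `n` vectors of the family are orthonormal up to an error `δ`. -/
def NearlyOrthonormal (g : Fin d → E) (n : ℕ) (δ : ℝ) : Prop :=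
  ∀ y : Fin d → ℝ, |‖initialCombination g n y‖ ^ 2 - ∑ i with i.val < n, y i ^ 2|
    ≤ δ * ∑ i with i.val < n, y i ^ 2

theorem inner_initialCombination (g : Fin d → E) (n : ℕ) (y : Fin d → ℝ) (x : E) :
    inner ℝ (initialCombination g n y) x = ∑ i with i.val < n, y i * inner ℝ (g i) x := by
  rw [initialCombination_apply, sum_inner]
  simp only [real_inner_smul_left]

namespace NearlyOrthonormal

variable {g : Fin d → E} {n : ℕ} {δ : ℝ}

theorem abs_inner_sub_le (h : NearlyOrthonormal g n δ) (hδ : 0 ≤ δ) (y z : Fin d → ℝ) :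
    |inner ℝ (initialCombination g n y) (initialCombination g n z) - ∑ i with i.val < n, y i * z i|
      ≤ δ * (√(∑ i, y i ^ 2) * √(∑ i, z i ^ 2)) := by
  let W := initialCombination g n
  let B : LinearMap.BilinForm ℝ (EuclideanSpace ℝ (Fin d)) := LinearMap.mk₂ ℝ
    (fun y z => inner ℝ (W y) (W z) - ∑ i with i.val < n, y i * z i)
    (fun x y z => by
      simp only [WithLp.ofLp_add, map_add, inner_add_left, Pi.add_apply, add_mul,
        Finset.sum_add_distrib]; ring)
    (fun r x y => by
      simp only [WithLp.ofLp_smul, map_smul, real_inner_smul_left, Pi.smul_apply, smul_eq_mul,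
        mul_assoc, ← Finset.mul_sum]; ring)
    (fun x y z => by
      simp only [WithLp.ofLp_add, map_add, inner_add_right, Pi.add_apply, mul_add,
        Finset.sum_add_distrib]; ring)
    (fun r x y => by
      simp only [WithLp.ofLp_smul, map_smul, real_inner_smul_right, Pi.smul_apply, smul_eq_mul,
        mul_left_comm _ r, ← Finset.mul_sum]; ring)
  have hBs : ∀ x y, B x y = B y x := fun x y => by
    simp only [B, LinearMap.mk₂_apply, real_inner_comm, mul_comm]
  have hBq : ∀ x, |B x x| ≤ δ * ‖x‖ ^ 2 := fun x => by
    simp only [B, LinearMap.mk₂_apply, real_inner_self_eq_norm_sq, ← sq]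
    refine (h x).trans ?_
    rw [EuclideanSpace.real_norm_sq_eq]
    exact mul_le_mul_of_nonneg_left (Finset.sum_le_sum_of_subset_of_nonneg
      (Finset.filter_subset _ _) fun i _ _ => sq_nonneg (x i)) hδ
  have := abs_bilin_le_of_abs_quad_le B hBs hBq (WithLp.toLp 2 y) (WithLp.toLp 2 z)
  simpa [B, EuclideanSpace.norm_eq] using this

/-- Bessel's inequality by duality: take the inner products themselves as coefficients, so that the
sum equals `⟪W y, x⟫`, and apply Cauchy–Schwarz together with the bound on `‖W y‖`. -/
theorem sum_inner_sq_le (h : NearlyOrthonormal g n δ) (hδ : 0 ≤ δ) (x : E) :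
    ∑ i with i.val < n, inner ℝ (g i) x ^ 2 ≤ (1 + δ) * ‖x‖ ^ 2 := by
  set Q := ∑ i with i.val < n, inner ℝ (g i) x ^ 2 with hQ
  have hQ0 : 0 ≤ Q := Finset.sum_nonneg fun _ _ => sq_nonneg _
  have h1 := (abs_le.1 (h fun i => inner ℝ (g i) x)).2
  have h2 := inner_initialCombination g n (fun i => inner ℝ (g i) x) x
  simp only [← sq] at h2
  have h3 := real_inner_le_norm (initialCombination g n fun i => inner ℝ (g i) x) x
  rw [h2] at h3
  by_contra! hcon
  have hpos : 0 < Q := lt_of_le_of_lt (by positivity) hcon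
  have h4 : Q ^ 2 ≤ (1 + δ) * Q * ‖x‖ ^ 2 := by
    calc Q ^ 2 ≤ (‖initialCombination g n fun i => inner ℝ (g i) x‖ * ‖x‖) ^ 2 := by gcongr
      _ = ‖initialCombination g n fun i => inner ℝ (g i) x‖ ^ 2 * ‖x‖ ^ 2 := mul_pow _ _ _
      _ ≤ (1 + δ) * Q * ‖x‖ ^ 2 := by gcongr; linarith
  nlinarith

theorem sum_sq_le (h : NearlyOrthonormal g n δ) (hδ : δ ≤ 1 / 2) (y : Fin d → ℝ) :
    ∑ i with i.val < n, y i ^ 2 ≤ 2 * ‖initialCombination g n y‖ ^ 2 := by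
  have h1 := (abs_le.1 (h y)).1
  have h0 : 0 ≤ ∑ i with i.val < n, y i ^ 2 := Finset.sum_nonneg fun _ _ => sq_nonneg _
  nlinarith

/-- Cauchy–Schwarz applied to `‖x‖ ^ 2 = ∑ y i * ⟪g i, x⟫`, with `∑ y i ^ 2 ≤ ‖x‖ ^ 2 / (1 - δ)`. -/
theorem le_sum_inner_sq (h : NearlyOrthonormal g n δ) (hδ : δ ≤ 1 / 2) (y : Fin d → ℝ) :
    (1 - δ) * ‖initialCombination g n y‖ ^ 2
      ≤ ∑ i with i.val < n, inner ℝ (g i) (initialCombination g n y) ^ 2 := by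
  set x := initialCombination g n y with hx
  have h1 := (abs_le.1 (h y)).1
  set Q := ∑ i with i.val < n, inner ℝ (g i) x ^ 2 with hQ
  have hQ0 : 0 ≤ Q := Finset.sum_nonneg fun _ _ => sq_nonneg _
  set Y := ∑ i with i.val < n, y i ^ 2 with hY
  have hY0 : 0 ≤ Y := Finset.sum_nonneg fun _ _ => sq_nonneg _
  have h2 := inner_initialCombination g n y x
  rw [← hx, real_inner_self_eq_norm_sq] at h2
  have h3 := Finset.sum_mul_sq_le_sq_mul_sq (Finset.univ.filter fun i : Fin d => i.val < n) y
    (fun i => inner ℝ (g i) x)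
  rw [← h2] at h3
  rw [← hx] at h1
  by_contra! hcon
  have hpos : 0 < ‖x‖ ^ 2 := by
    by_contra hz
    have : ‖x‖ ^ 2 = 0 := le_antisymm (not_lt.1 hz) (sq_nonneg _)
    rw [this] at hcon
    linarith
  have h4 : (1 - δ) * Y ≤ ‖x‖ ^ 2 := by linarith
  have h5 : (1 - δ) * (‖x‖ ^ 2) ^ 2 ≤ ‖x‖ ^ 2 * Q := by
    calc (1 - δ) * (‖x‖ ^ 2) ^ 2 ≤ (1 - δ) * (Y * Q) := by
          gcongr; linarith
      _ = (1 - δ) * Y * Q := by ring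
      _ ≤ ‖x‖ ^ 2 * Q := by gcongr
  nlinarith

/-- The vectors with index in `[n, m)` are nearly orthogonal to the span of the first `n`. -/
theorem sum_inner_initialCombination_sq_le {m : ℕ} (h : NearlyOrthonormal g m δ) (hδ : 0 ≤ δ)
    (hnm : n ≤ m) (y : Fin d → ℝ) :
    ∑ i with n ≤ i.val ∧ i.val < m, inner ℝ (g i) (initialCombination g n y) ^ 2
      ≤ δ ^ 2 * ∑ i with i.val < n, y i ^ 2 := by
  set x := initialCombination g n y with hx
  -- The coefficient vectors `y'` and `z` have disjoint supports, so the inner product of their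
  -- combinations, which is `Q`, is pure Gram error: `Q ≤ δ * √Q * √Y`.
  let y' : Fin d → ℝ := fun i => if i.val < n then y i else 0
  let z : Fin d → ℝ := fun i => if n ≤ i.val ∧ i.val < m then inner ℝ (g i) x else 0
  set Q := ∑ i with n ≤ i.val ∧ i.val < m, inner ℝ (g i) x ^ 2 with hQ
  have hQ0 : 0 ≤ Q := Finset.sum_nonneg fun _ _ => sq_nonneg _
  have hW : initialCombination g m y' = x := by
    rw [hx, initialCombination_apply, initialCombination_apply, Finset.sum_filter,
      Finset.sum_filter]
    refine Finset.sum_congr rfl fun i _ => ?_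
    by_cases h1 : i.val < n
    · simp [y', h1, h1.trans_le hnm]
    · simp [y', h1]
  have hz : ∑ i, z i ^ 2 = Q := by
    rw [hQ, Finset.sum_filter]
    exact Finset.sum_congr rfl fun i _ => by simp only [z]; split_ifs <;> simp
  have hy : ∑ i, y' i ^ 2 = ∑ i with i.val < n, y i ^ 2 := by
    rw [Finset.sum_filter]
    exact Finset.sum_congr rfl fun i _ => by simp only [y']; split_ifs <;> simp
  have hin : inner ℝ (initialCombination g m z) (initialCombination g m y') = Q := by
    rw [hW, inner_initialCombination, hQ, Finset.sum_filter, Finset.sum_filter]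
    refine Finset.sum_congr rfl fun i _ => ?_
    by_cases h1 : i.val < m
    · by_cases h2 : n ≤ i.val
      · simp [z, h1, h2, sq]
      · simp [z, h1, h2]
    · simp [h1]
  have hzy : ∑ i with i.val < m, z i * y' i = 0 := by
    refine Finset.sum_eq_zero fun i _ => ?_
    by_cases h1 : i.val < n
    · simp [z, not_le.2 h1]
    · simp [y', h1]
  have h1 := h.abs_inner_sub_le hδ z y'
  rw [hin, hzy, sub_zero, abs_of_nonneg hQ0, hz, hy] at h1
  set Y := ∑ i with i.val < n, y i ^ 2 with hY
  have hY0 : 0 ≤ Y := Finset.sum_nonneg fun _ _ => sq_nonneg _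
  have h2 : Q ^ 2 ≤ δ ^ 2 * Y * Q := by
    calc Q ^ 2 ≤ (δ * (√Q * √Y)) ^ 2 := by gcongr
      _ = δ ^ 2 * (√Q ^ 2 * √Y ^ 2) := by ring
      _ = δ ^ 2 * Y * Q := by rw [Real.sq_sqrt hQ0, Real.sq_sqrt hY0]; ring
  rcases hQ0.eq_or_lt with h0 | h0
  · rw [← h0]; positivity
  · nlinarith

end NearlyOrthonormal

end Deterministic

/-! ### Good families and subspaces where the form is large or small -/

section Deterministic

variable {E : Type*} [NormedAddCommGroup E] [InnerProductSpace ℝ E] {d : ℕ}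

/-- The regularity of a family `g` that makes the spectrum of `∑ aᵢ gᵢ gᵢᵀ` close to `a`, up to a
shift by `c`: initial segments of `g` are nearly orthonormal, and the part of the form with weights
below `1 / √k` is nearly `c` times the identity. -/
structure IsGoodFamily (k : ℕ) (D c : ℝ) (a : Fin d → ℝ) (g : Fin d → E) : Prop where
  gram : ∀ n ≤ k, NearlyOrthonormal g n (D * (√n / √k))
  tail : ∀ x : E, |∑ i, (if 1 / √k ≤ |a i| then 0 else a i) * inner ℝ (g i) x ^ 2 - c * ‖x‖ ^ 2|
    ≤ D / √k * ‖x‖ ^ 2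

/-- The quadratic form of the vectors of index at least `n` with weight at least `1 / √k`. -/
noncomputable def middleForm (k n : ℕ) (a : Fin d → ℝ) (g : Fin d → E) (x : E) : ℝ :=
  ∑ i, (if n ≤ i.val ∧ 1 / √k ≤ |a i| then |a i| else 0) * inner ℝ (g i) x ^ 2

theorem middleForm_add_le (k n : ℕ) (a : Fin d → ℝ) (g : Fin d → E) (x y : E) :
    middleForm k n a g (x + y) ≤ 2 * middleForm k n a g x + 2 * middleForm k n a g y := by
  unfold middleForm
  rw [Finset.mul_sum, Finset.mul_sum, ← Finset.sum_add_distrib]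
  refine Finset.sum_le_sum fun i _ => ?_
  rw [inner_add_right]
  have h0 : 0 ≤ (if n ≤ i.val ∧ 1 / √k ≤ |a i| then |a i| else 0 : ℝ) := by
    split_ifs <;> positivity
  nlinarith [mul_nonneg h0 (sq_nonneg (inner ℝ (g i) x - inner ℝ (g i) y))]

namespace IsGoodFamily

variable {k : ℕ} {D c : ℝ} {a : Fin d → ℝ} {g : Fin d → E}

theorem neg (h : IsGoodFamily k D c a g) : IsGoodFamily k D (-c) (-a) g where
  gram := h.gram
  tail x := by
    have := h.tail x
    rw [← abs_neg] at this
    convert this using 2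
    rw [neg_sub, neg_mul, sub_neg_eq_add, sub_eq_add_neg, add_comm, ← Finset.sum_neg_distrib]
    congr 1
    exact Finset.sum_congr rfl fun i _ => by
      simp only [Pi.neg_apply, abs_neg]; split_ifs <;> ring

/-- By the Gram bound at length `m`, the squared inner products with indices in `[n, m)` sum to at
most `D ^ 2 * m / k * Y`, as if each were at most `D ^ 2 / k * Y`. Abel summation against the
decreasing weights multiplies this by the total weight, at most `√k` since a weight `|a i| ≥ 1 / √k`
is at most `√k * a i ^ 2`. -/
theorem middleForm_initialCombination_le (hk : k ≠ 0) (hD : 1 ≤ D)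
    (ha : ∑ i, a i ^ 2 ≤ 1) (hanti : Antitone fun i => |a i|)
    (h : IsGoodFamily k D c a g) (n : ℕ) (y : Fin d → ℝ) :
    middleForm k n a g (initialCombination g n y)
      ≤ D ^ 2 / √k * ∑ i with i.val < n, y i ^ 2 := by
  set Y := ∑ i with i.val < n, y i ^ 2 with hY
  have hY0 : 0 ≤ Y := Finset.sum_nonneg fun _ _ => sq_nonneg _
  set x := initialCombination g n y with hx
  have hk0 : (0 : ℝ) < k := by positivity
  have hD0 : 0 ≤ D := by linarith
  have hsk : 0 < √(k : ℝ) := Real.sqrt_pos.2 hk0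
  obtain ⟨K, hK⟩ : ∃ K, K = (Finset.univ.filter fun j => 1 / √k ≤ |a j|).card := ⟨_, rfl⟩
  have hKiff := fun i => Fin.superlevel_eq_initial hanti (1 / √k) i
  simp only [← hK] at hKiff
  have hKk : K ≤ k := by
    have := card_superlevel_mul_sq_le ha (t := 1 / √k) (by positivity)
    rw [← hK, div_pow, Real.sq_sqrt hk0.le, one_pow, mul_one_div, div_le_one hk0] at this
    exact_mod_cast this
  let w : Fin d → ℝ := fun i => if 1 / √k ≤ |a i| then |a i| else 0
  have hw0 : ∀ i, 0 ≤ w i := fun i => by simp only [w]; split_ifs <;> positivity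
  have hw : Antitone w := by
    intro i j hij
    have h1 := hanti hij
    simp only at h1
    by_cases hj : 1 / √k ≤ |a j|
    · simp only [w, hj, hj.trans h1, if_true, h1]
    · simp only [w, hj, if_false]; exact hw0 i
  have hwsum : ∑ i, w i ≤ √k := by
    calc ∑ i, w i ≤ ∑ i, √k * a i ^ 2 := Finset.sum_le_sum fun i _ => by
          simp only [w]
          split_ifs with h1
          · rw [div_le_iff₀ hsk] at h1
            rw [← sq_abs]
            nlinarith [abs_nonneg (a i)]
          · positivity
      _ = √k * ∑ i, a i ^ 2 := by rw [Finset.mul_sum]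
      _ ≤ √k * 1 := by gcongr
      _ = √k := mul_one _
  let f : Fin d → ℝ := fun i => if n ≤ i.val ∧ i.val < K then inner ℝ (g i) x ^ 2 else 0
  have hf : middleForm k n a g x = ∑ i, w i * f i := by
    refine Finset.sum_congr rfl fun i _ => ?_
    by_cases h1 : 1 / √k ≤ |a i|
    · have h2 := (hKiff i).1 h1
      by_cases h3 : n ≤ i.val <;> simp only [w, f, h1, h2, h3, and_self, and_true,
        if_true, if_false, zero_mul, mul_zero]
    · simp only [w, h1, and_false, if_false, zero_mul]
  have hpart : ∀ m ≤ d, 0 ≤ ∑ i with i.val < m, (D ^ 2 / k * Y - f i) := by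
    intro m hm
    have hcard : (Finset.univ.filter fun i : Fin d => i.val < m).card = m := by
      rw [Fin.card_filter_val_lt, min_eq_right hm]
    rw [Finset.sum_sub_distrib, Finset.sum_const, hcard, nsmul_eq_mul, sub_nonneg]
    obtain ⟨m', hm'⟩ : ∃ m', m' = min m K := ⟨_, rfl⟩
    have h1 : ∑ i with i.val < m, f i
        = ∑ i with n ≤ i.val ∧ i.val < m', inner ℝ (g i) x ^ 2 := by
      rw [Finset.sum_filter, Finset.sum_filter]
      refine Finset.sum_congr rfl fun i _ => ?_
      simp only [f, hm', lt_min_iff]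
      by_cases h2 : i.val < m <;> simp [h2]
    rw [h1]
    rcases le_or_gt n m' with hnm | hnm
    · refine ((h.gram m' (by omega)).sum_inner_initialCombination_sq_le
        (mul_nonneg hD0 (by positivity)) hnm y).trans ?_
      rw [mul_pow, div_pow, Real.sq_sqrt (Nat.cast_nonneg _), Real.sq_sqrt hk0.le]
      have : (m' : ℝ) ≤ m := by rw [hm']; exact_mod_cast min_le_left _ _
      calc D ^ 2 * (m' / k) * Y ≤ D ^ 2 * (m / k) * Y := by gcongr
        _ = m * (D ^ 2 / k * Y) := by ring
    · rw [Finset.sum_eq_zero]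
      · positivity
      · intro i hi
        simp only [Finset.mem_filter, Finset.mem_univ, true_and] at hi
        omega
  have habel := Fin.sum_mul_nonneg_of_antitone hw hw0 hpart
  simp only [mul_sub, Finset.sum_sub_distrib, ← Finset.sum_mul, sub_nonneg] at habel
  rw [hf]
  refine habel.trans ?_
  calc (∑ i, w i) * (D ^ 2 / k * Y) ≤ √k * (D ^ 2 / k * Y) := by gcongr
    _ = D ^ 2 / √k * Y := by
      nth_rewrite 2 [← Real.mul_self_sqrt hk0.le]
      field_simp

/-- A cruder bound for arbitrary `x`: at most `k` weights reach `1 / √k`, and Bessel's inequality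
for their vectors loses only a factor `1 + D`. -/
theorem middleForm_le (hk : k ≠ 0) (hD : 1 ≤ D)
    (ha : ∑ i, a i ^ 2 ≤ 1) (hanti : Antitone fun i => |a i|)
    (h : IsGoodFamily k D c a g) {t : ℝ} (ht : 0 ≤ t) {n : ℕ}
    (hn : ∀ i : Fin d, n ≤ i.val → |a i| ≤ t) (x : E) :
    middleForm k n a g x ≤ t * (1 + D) * ‖x‖ ^ 2 := by
  have hk0 : (0 : ℝ) < k := by positivity
  have hD0 : 0 ≤ D := by linarith
  have hsk : 0 < √(k : ℝ) := Real.sqrt_pos.2 hk0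
  obtain ⟨K, hK⟩ : ∃ K, K = (Finset.univ.filter fun j => 1 / √k ≤ |a j|).card := ⟨_, rfl⟩
  have hKiff := fun i => Fin.superlevel_eq_initial hanti (1 / √k) i
  simp only [← hK] at hKiff
  have hKk : K ≤ k := by
    have := card_superlevel_mul_sq_le ha (t := 1 / √k) (by positivity)
    rw [← hK, div_pow, Real.sq_sqrt hk0.le, one_pow, mul_one_div, div_le_one hk0] at this
    exact_mod_cast this
  have h1 := (h.gram K hKk).sum_inner_sq_le (mul_nonneg hD0 (by positivity)) x
  have h2 : D * (√K / √k) ≤ D := by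
    have : √(K : ℝ) / √k ≤ 1 := by
      rw [div_le_one hsk]; gcongr
    nlinarith
  calc middleForm k n a g x ≤ ∑ i with i.val < K, t * inner ℝ (g i) x ^ 2 := by
        rw [Finset.sum_filter]
        refine Finset.sum_le_sum fun i _ => ?_
        by_cases h3 : n ≤ i.val ∧ 1 / √k ≤ |a i|
        · rw [if_pos h3, if_pos ((hKiff i).1 h3.2)]
          gcongr
          exact hn i h3.1
        · rw [if_neg h3, zero_mul]
          split_ifs <;> positivity
    _ = t * ∑ i with i.val < K, inner ℝ (g i) x ^ 2 := by rw [Finset.mul_sum]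
    _ ≤ t * ((1 + D) * ‖x‖ ^ 2) := by
        gcongr
        exact h1.trans (by gcongr)
    _ = t * (1 + D) * ‖x‖ ^ 2 := by ring

theorem abs_form_sub_le (h : IsGoodFamily k D c a g) {n : ℕ}
    (hn : ∀ i : Fin d, i.val < n → 1 / √k ≤ |a i|) (x : E) :
    |∑ i, a i * inner ℝ (g i) x ^ 2 - c * ‖x‖ ^ 2 - ∑ i with i.val < n, a i * inner ℝ (g i) x ^ 2|
      ≤ middleForm k n a g x + D / √k * ‖x‖ ^ 2 := by
  set M := ∑ i, (if n ≤ i.val ∧ 1 / √k ≤ |a i| then a i else 0) * inner ℝ (g i) x ^ 2 with hM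
  have h1 : ∑ i, a i * inner ℝ (g i) x ^ 2 = ∑ i with i.val < n, a i * inner ℝ (g i) x ^ 2 + M +
      ∑ i, (if 1 / √k ≤ |a i| then 0 else a i) * inner ℝ (g i) x ^ 2 := by
    rw [Finset.sum_filter, hM, ← Finset.sum_add_distrib, ← Finset.sum_add_distrib]
    refine Finset.sum_congr rfl fun i _ => ?_
    by_cases h2 : i.val < n
    · simp only [h2, not_le.2 h2, hn i h2, false_and, if_true, if_false]; ring
    · by_cases h3 : 1 / √k ≤ |a i|
      · simp only [h2, not_lt.1 h2, h3, and_self, if_true, if_false]; ring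
      · simp only [h2, h3, and_false, if_false]; ring
  have h2 : |M| ≤ middleForm k n a g x := by
    refine (Finset.abs_sum_le_sum_abs _ _).trans (Finset.sum_le_sum fun i _ => ?_)
    rw [abs_mul, abs_of_nonneg (sq_nonneg (inner ℝ (g i) x))]
    split_ifs <;> simp
  calc _ = |M + (∑ i, (if 1 / √k ≤ |a i| then 0 else a i) * inner ℝ (g i) x ^ 2
        - c * ‖x‖ ^ 2)| := by rw [h1]; congr 1; ring
    _ ≤ _ := (abs_add_le _ _).trans (add_le_add h2 (h.tail x))

/-- For a level `s` there is an initial segment that contains all weights above a fraction of `s`,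
on which the family is nearly orthonormal with relative error `O(1 / (s √k))`. -/
theorem exists_initial_segment (hk : k ≠ 0) (hD : 1 ≤ D)
    (ha : ∑ i, a i ^ 2 ≤ 1) (hanti : Antitone fun i => |a i|)
    (h : IsGoodFamily k D c a g) {s : ℝ}
    (hs : 8 * D * (1 + D) / √k ≤ s) :
    ∃ (n : ℕ) (δ : ℝ), NearlyOrthonormal g n δ ∧ 0 ≤ δ ∧ δ ≤ 1 / 2 ∧
      δ * s ≤ 4 * D * (1 + D) / √k ∧ (∀ i : Fin d, i.val < n → 1 / √k ≤ |a i|) ∧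
      (∀ i : Fin d, s ≤ |a i| → i.val < n) ∧ ∀ x, middleForm k n a g x ≤ s / 4 * ‖x‖ ^ 2 := by
  have hk0 : (0 : ℝ) < k := by positivity
  have hD0 : 0 ≤ D := by linarith
  have hsk : 0 < √(k : ℝ) := Real.sqrt_pos.2 hk0
  have hD1 : 0 < 1 + D := by linarith
  have hs0 : 0 < s := lt_of_lt_of_le (by positivity) hs
  -- The cut-off is chosen so that `middleForm_le` gives exactly `s / 4`. It exceeds `1 / √k`, so
  -- the head has at most `k` vectors, and `√n * t ≤ 1` makes `δ * s` of order `1 / √k`.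
  set t := s / (4 * (1 + D)) with ht
  have ht0 : 0 < t := by positivity
  have hts : s = t * (4 * (1 + D)) := by rw [ht]; field_simp
  have hkt : 2 * D / √k ≤ t := by
    rw [ht, le_div_iff₀ (by positivity)]
    refine le_trans (le_of_eq ?_) hs
    ring
  have hkt1 : 1 / √k ≤ t := le_trans (by gcongr; linarith) hkt
  obtain ⟨n, hn⟩ : ∃ n, n = (Finset.univ.filter fun j => t ≤ |a j|).card := ⟨_, rfl⟩
  have hniff := fun i => Fin.superlevel_eq_initial hanti t i
  simp only [← hn] at hniff
  have hnt := card_superlevel_mul_sq_le ha ht0.le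
  rw [← hn] at hnt
  have hsn : √n * t ≤ 1 := by
    rw [← Real.sqrt_sq ht0.le, ← Real.sqrt_mul (Nat.cast_nonneg _)]
    exact Real.sqrt_le_one.2 hnt
  have hnk : √(n : ℝ) ≤ √k := by
    have h1 : √(n : ℝ) * (1 / √k) ≤ 1 := le_trans (by gcongr) hsn
    rwa [mul_one_div, div_le_one hsk] at h1
  have hnk' : n ≤ k := by
    rw [Real.sqrt_le_sqrt_iff hk0.le] at hnk
    exact_mod_cast hnk
  have hδs : D * (√n / √k) * s ≤ 4 * D * (1 + D) / √k := by
    calc D * (√n / √k) * s = 4 * D * (1 + D) / √k * (√n * t) := by rw [hts]; ring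
      _ ≤ 4 * D * (1 + D) / √k * 1 := by gcongr
      _ = _ := mul_one _
  refine ⟨n, D * (√n / √k), h.gram n hnk', mul_nonneg hD0 (by positivity), ?_, hδs, fun i hi => ?_, fun i hi => ?_,
    fun x => ?_⟩
  · have h1 : D * (√n / √k) * s ≤ 1 / 2 * s := by
      refine hδs.trans (le_trans (le_of_eq ?_) (mul_le_mul_of_nonneg_left hs (by norm_num)))
      ring
    exact le_of_mul_le_mul_right h1 hs0
  · exact hkt1.trans ((hniff i).2 hi)
  · refine (hniff i).1 (le_trans ?_ hi)
    rw [ht]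
    exact div_le_self hs0.le (by linarith)
  · refine (h.middleForm_le hk hD ha hanti ht0.le (fun i hi => ?_) x).trans (le_of_eq ?_)
    · by_contra! hcon
      exact absurd ((hniff i).1 hcon.le) (by omega)
    · rw [hts]; ring

/-- The subspace consists of the combinations of the head that are orthogonal to every head vector
of weight below `s`. There the head form is at least `s` times the sum of squared inner products,
hence at least `s * (1 - δ) * ‖x‖ ^ 2`; the middle and tail cost `O(1 / √k)`. -/
theorem exists_large_subspace_form_ge (hk : k ≠ 0) (hD : 1 ≤ D)
    (ha : ∑ i, a i ^ 2 ≤ 1) (hanti : Antitone fun i => |a i|)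
    (h : IsGoodFamily k D c a g) {s : ℝ}
    (hs : 8 * D * (1 + D) / √k ≤ s) :
    ∃ V : Submodule ℝ E, (Finset.univ.filter fun i => s ≤ a i).card ≤ Module.finrank ℝ V ∧
      ∀ x ∈ V, (s - (4 * D * (1 + D) + 4 * D ^ 2 + D) / √k) * ‖x‖ ^ 2
        ≤ ∑ i, a i * inner ℝ (g i) x ^ 2 - c * ‖x‖ ^ 2 := by
  have hk0 : (0 : ℝ) < k := by positivity
  have hD0 : 0 ≤ D := by linarith
  have hsk : 0 < √(k : ℝ) := Real.sqrt_pos.2 hk0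
  have hD1 : 0 < 1 + D := by linarith
  have hs0 : 0 < s := lt_of_lt_of_le (by positivity) hs
  obtain ⟨n, δ, hg, hδ0, hδ, hδs, hnk, hns, -⟩ := h.exists_initial_segment hk hD ha hanti hs
  have hsn : ∀ i : Fin d, s ≤ a i → i.val < n := fun i hi => hns i (hi.trans (le_abs_self _))
  let W := initialCombination g n
  -- One condition per index with `a i < s`: orthogonality inside the head, a vanishing coordinate
  -- outside. The kernel therefore has dimension at least the number of indices with `s ≤ a i`.
  let ψ : (Fin d → ℝ) →ₗ[ℝ] ({i : Fin d // ¬ s ≤ a i} → ℝ) := LinearMap.pi fun i =>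
    if i.1.val < n then (innerₛₗ ℝ (g i.1)) ∘ₗ W else LinearMap.proj i.1
  have hker : ∀ y ∈ LinearMap.ker ψ, (∀ i : Fin d, n ≤ i.val → y i = 0) ∧
      ∀ i : Fin d, i.val < n → ¬ s ≤ a i → inner ℝ (g i) (W y) = 0 := by
    intro y hy
    rw [LinearMap.mem_ker] at hy
    refine ⟨fun i hi => ?_, fun i hi hsi => ?_⟩
    · have h1 := congrFun hy ⟨i, fun hsi => absurd (hsn i hsi) (by omega)⟩
      simpa [ψ, not_lt.2 hi] using h1
    · have h1 := congrFun hy ⟨i, hsi⟩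
      simpa [ψ, hi] using h1
  have hdim : (Finset.univ.filter fun i => s ≤ a i).card ≤ Module.finrank ℝ (LinearMap.ker ψ) := by
    have h1 := ψ.finrank_range_add_finrank_ker
    have h2 := (LinearMap.range ψ).finrank_le
    rw [Module.finrank_fintype_fun_eq_card] at h1 h2
    rw [Fintype.card_fin] at h1
    rw [Fintype.card_subtype] at h2
    have h3 := Finset.card_filter_add_card_filter_not (s := Finset.univ) fun i => s ≤ a i
    rw [Finset.card_univ, Fintype.card_fin] at h3
    omega
  have hinj : Function.Injective (W.domRestrict (LinearMap.ker ψ)) := by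
    rw [← LinearMap.ker_eq_bot, LinearMap.ker_eq_bot']
    rintro ⟨y, hy⟩ hWy
    have h1 : W y = 0 := hWy
    have h2 := hg.sum_sq_le hδ y
    rw [show initialCombination g n y = 0 from h1, norm_zero] at h2
    have h3 : ∀ i ∈ Finset.univ.filter (fun i : Fin d => i.val < n), y i ^ 2 = 0 :=
      (Finset.sum_eq_zero_iff_of_nonneg fun _ _ => sq_nonneg _).1
        (le_antisymm (by simpa using h2) (Finset.sum_nonneg fun _ _ => sq_nonneg _))
    ext i
    by_cases hi : i.val < n
    · simpa using h3 i (by simpa using hi)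
    · exact (hker y hy).1 i (not_lt.1 hi)
  refine ⟨LinearMap.range (W.domRestrict (LinearMap.ker ψ)), ?_, ?_⟩
  · rwa [LinearMap.finrank_range_of_inj hinj]
  · rintro x ⟨⟨y, hy⟩, rfl⟩
    simp only [LinearMap.domRestrict_apply]
    set x := W y with hx
    have h1 := (abs_le.1 (h.abs_form_sub_le hnk x)).1
    have h2 := h.middleForm_initialCombination_le hk hD ha hanti n y
    have h3 := hg.sum_sq_le hδ y
    have h4 := hg.le_sum_inner_sq hδ y
    rw [show initialCombination g n y = x from rfl] at h2 h3 h4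
    have h5 : s * ∑ i with i.val < n, inner ℝ (g i) x ^ 2
        ≤ ∑ i with i.val < n, a i * inner ℝ (g i) x ^ 2 := by
      rw [Finset.mul_sum]
      refine Finset.sum_le_sum fun i hi => ?_
      have hi' : i.val < n := by simpa using hi
      by_cases hsi : s ≤ a i
      · gcongr
      · rw [(hker y hy).2 i hi' hsi]; simp
    have h6 : s * ((1 - δ) * ‖x‖ ^ 2) ≤ s * ∑ i with i.val < n, inner ℝ (g i) x ^ 2 := by gcongr
    have h7 : D ^ 2 / √k * ∑ i with i.val < n, y i ^ 2 ≤ D ^ 2 / √k * (2 * ‖x‖ ^ 2) := by gcongr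
    have h8 : δ * s * ‖x‖ ^ 2 ≤ 4 * D * (1 + D) / √k * ‖x‖ ^ 2 := by gcongr
    have h9 : 0 ≤ D ^ 2 / √k * ‖x‖ ^ 2 := by positivity
    have h10 : (s - (4 * D * (1 + D) + 4 * D ^ 2 + D) / √k) * ‖x‖ ^ 2 = s * ‖x‖ ^ 2
      - 4 * D * (1 + D) / √k * ‖x‖ ^ 2 - 4 * (D ^ 2 / √k * ‖x‖ ^ 2) - D / √k * ‖x‖ ^ 2 := by ring
    rw [h10]
    linarith

/-- The subspace is the orthogonal complement of the `g i` with `s < a i`. Splitting `x = p + q`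
along the span of the head, the head form sees only `p` and is at most `s * (1 + δ) * ‖p‖ ^ 2`. The
middle form is `O(1 / √k)` on `p` and at most `s / 4` on `q`, so doubling it to absorb cross terms
still fits in `s * ‖q‖ ^ 2`. -/
theorem exists_large_subspace_form_le [FiniteDimensional ℝ E] (hk : k ≠ 0) (hD : 1 ≤ D)
    (ha : ∑ i, a i ^ 2 ≤ 1) (hanti : Antitone fun i => |a i|)
    (h : IsGoodFamily k D c a g) {s : ℝ}
    (hs : 8 * D * (1 + D) / √k ≤ s) :
    ∃ V : Submodule ℝ E,
      Module.finrank ℝ E ≤ Module.finrank ℝ V + (Finset.univ.filter fun i => s < a i).card ∧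
      ∀ x ∈ V, ∑ i, a i * inner ℝ (g i) x ^ 2 - c * ‖x‖ ^ 2
        ≤ (s + (4 * D * (1 + D) + 4 * D ^ 2 + D) / √k) * ‖x‖ ^ 2 := by
  have hk0 : (0 : ℝ) < k := by positivity
  have hD0 : 0 ≤ D := by linarith
  have hsk : 0 < √(k : ℝ) := Real.sqrt_pos.2 hk0
  have hD1 : 0 < 1 + D := by linarith
  have hs0 : 0 < s := lt_of_lt_of_le (by positivity) hs
  obtain ⟨n, δ, hg, hδ0, hδ, hδs, hnk, -, hmid⟩ := h.exists_initial_segment hk hD ha hanti hs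
  let φ : E →ₗ[ℝ] ({i : Fin d // s < a i} → ℝ) := LinearMap.pi fun i => innerₛₗ ℝ (g i.1)
  refine ⟨LinearMap.ker φ, ?_, fun x hx => ?_⟩
  · have h1 := φ.finrank_range_add_finrank_ker
    have h2 := (LinearMap.range φ).finrank_le
    rw [Module.finrank_fintype_fun_eq_card, Fintype.card_subtype] at h2
    omega
  have hxz : ∀ i, s < a i → inner ℝ (g i) x = 0 := fun i hi => by
    have := congrFun (LinearMap.mem_ker.1 hx) ⟨i, hi⟩
    simpa [φ] using this
  obtain ⟨p, ⟨y, hy⟩, q, hq, hpq⟩ :=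
    (LinearMap.range (initialCombination g n)).exists_add_mem_mem_orthogonal x
  have hgmem : ∀ i : Fin d, i.val < n → g i ∈ LinearMap.range (initialCombination g n) :=
    fun i hi => ⟨Pi.single i 1, by
      rw [initialCombination_apply, Finset.sum_eq_single i]
      · simp
      · intro j _ hj; simp [hj]
      · intro hcon; simp [hi] at hcon⟩
  have hgq : ∀ i : Fin d, i.val < n → inner ℝ (g i) q = 0 := fun i hi =>
    (Submodule.mem_orthogonal _ _).1 hq _ (hgmem i hi)
  have hnorm : ‖x‖ ^ 2 = ‖p‖ ^ 2 + ‖q‖ ^ 2 := by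
    have h0 : inner ℝ p q = 0 := (Submodule.mem_orthogonal _ _).1 hq _ ⟨y, hy⟩
    rw [hpq, sq, sq, sq]
    exact norm_add_sq_eq_norm_sq_add_norm_sq_real h0
  have h1 := (abs_le.1 (h.abs_form_sub_le hnk x)).2
  have h2 := h.middleForm_initialCombination_le hk hD ha hanti n y
  have h3 := hg.sum_sq_le hδ y
  rw [hy] at h2 h3
  have h4 := hg.sum_inner_sq_le hδ0 p
  have h5 : ∑ i with i.val < n, a i * inner ℝ (g i) x ^ 2
      ≤ s * ∑ i with i.val < n, inner ℝ (g i) p ^ 2 := by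
    rw [Finset.mul_sum]
    refine Finset.sum_le_sum fun i hi => ?_
    have hi' : i.val < n := by simpa using hi
    have hpx : inner ℝ (g i) p = inner ℝ (g i) x := by
      rw [hpq, inner_add_right, hgq i hi', add_zero]
    rw [hpx]
    by_cases hsi : s < a i
    · rw [hxz i hsi]; simp
    · gcongr; exact not_lt.1 hsi
  have h6 : s * ∑ i with i.val < n, inner ℝ (g i) p ^ 2 ≤ s * ((1 + δ) * ‖p‖ ^ 2) := by gcongr
  have h7 : D ^ 2 / √k * ∑ i with i.val < n, y i ^ 2 ≤ D ^ 2 / √k * (2 * ‖p‖ ^ 2) := by gcongr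
  have h8 : δ * s * ‖p‖ ^ 2 ≤ 4 * D * (1 + D) / √k * ‖p‖ ^ 2 := by gcongr
  have h9 := middleForm_add_le k n a g p q
  rw [← hpq] at h9
  have h10 := hmid q
  have h11 : 0 ≤ (4 * D * (1 + D) + 4 * D ^ 2) / √k * ‖q‖ ^ 2 := by positivity
  have h12 : 0 ≤ s * ‖q‖ ^ 2 := by positivity
  have h13 : (s + (4 * D * (1 + D) + 4 * D ^ 2 + D) / √k) * ‖x‖ ^ 2 = s * ‖p‖ ^ 2 + s * ‖q‖ ^ 2
      + 4 * D * (1 + D) / √k * ‖p‖ ^ 2 + 4 * (D ^ 2 / √k * ‖p‖ ^ 2)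
      + (4 * D * (1 + D) + 4 * D ^ 2) / √k * ‖q‖ ^ 2 + D / √k * ‖x‖ ^ 2 := by
    rw [hnorm]; ring
  rw [h13]
  linarith

end IsGoodFamily

end Deterministic

/-! ### From counting functions to sorted lists -/

section Counting

theorem card_filter_comp_equiv {α β : Type*} [Fintype α] [Fintype β] (σ : α ≃ β) (p : β → Prop)
    [DecidablePred p] :
    (Finset.univ.filter fun i => p (σ i)).card = (Finset.univ.filter p).card := by
  refine Finset.card_equiv σ fun i => ?_
  simp

theorem sortDecreasing_antitone {N : ℕ} (v : Fin N → ℝ) : Antitone (sortDecreasing v) :=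
  fun _ _ hij => Tuple.monotone_sort v (Fin.rev_le_rev.2 hij)

theorem card_filter_sortDecreasing {N : ℕ} (v : Fin N → ℝ) (p : ℝ → Prop) [DecidablePred p] :
    (Finset.univ.filter fun i => p (sortDecreasing v i)).card
      = (Finset.univ.filter fun i => p (v i)).card :=
  card_filter_comp_equiv ((Fin.revPerm : Equiv.Perm (Fin N)).trans (Tuple.sort v)) fun i => p (v i)

theorem card_filter_le_zeroPad {m N : ℕ} (h : m ≤ N) (v : Fin m → ℝ) (p : ℝ → Prop)
    [DecidablePred p] : (Finset.univ.filter fun i => p (v i)).card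
      ≤ (Finset.univ.filter fun i => p (zeroPad N v i)).card := by
  refine Finset.card_le_card_of_injOn (Fin.castLE h) (fun i hi => ?_)
    (Fin.castLE_injective h).injOn
  rw [Finset.mem_coe, Finset.mem_filter] at hi ⊢
  simpa [zeroPad] using hi

theorem card_filter_zeroPad_le {m N : ℕ} (h : m ≤ N) (v : Fin m → ℝ) (p : ℝ → Prop)
    [DecidablePred p] (h0 : ¬ p 0) : (Finset.univ.filter fun i => p (zeroPad N v i)).card
      ≤ (Finset.univ.filter fun i => p (v i)).card := by
  refine Finset.card_le_card_of_surjOn (Fin.castLE h) fun i hi => ?_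
  rw [Finset.mem_coe, Finset.mem_filter] at hi
  by_cases him : i.val < m
  · refine ⟨⟨i.val, him⟩, ?_, rfl⟩
    rw [Finset.mem_coe, Finset.mem_filter]
    simpa [zeroPad, him] using hi
  · have h1 := hi.2
    simp only [zeroPad, him, dif_neg, not_false_eq_true] at h1
    exact absurd h1 h0

/-- An entry `β i ≥ T` is handled by the counts from above, any other by the counts from below. The
latter need a level at least `T`, so entries near zero are compared at `-T`, at a cost of up to `2 *
T`. -/
theorem antitone_ge_sub_of_card_le {N : ℕ} {α β : Fin N → ℝ} (hα : Antitone α) (hβ : Antitone β)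
    {T e : ℝ}
    (hlo : ∀ s, T ≤ s → (Finset.univ.filter fun i => s ≤ β i).card
      ≤ (Finset.univ.filter fun i => s - e ≤ α i).card)
    (hup : ∀ s, T ≤ s → (Finset.univ.filter fun i => α i < -(s + e)).card
      ≤ (Finset.univ.filter fun i => β i < -s).card) (hT : 0 ≤ T) (i : Fin N) :
    β i - (e + 2 * T) ≤ α i := by
  rcases le_or_gt T (β i) with hi | hi
  · have h1 := (Fin.superlevel_eq_initial hβ (β i) i).1 le_rfl
    have h2 := (Fin.superlevel_eq_initial hα (β i - e) i).2 (h1.trans_le (hlo _ hi))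
    linarith
  · set s := max (-β i) T with hs
    have hsβ : -s ≤ β i := by linarith [le_max_left (-β i) T]
    have hsT : T ≤ s := le_max_right _ _
    have hsu : s ≤ 2 * T - β i := max_le (by linarith) (by linarith)
    have key : -(s + e) ≤ α i := by
      rw [Fin.superlevel_eq_initial hα]
      have h1 := (Fin.superlevel_eq_initial hβ (-s) i).1 hsβ
      have h2 := hup s hsT
      have h3 := Finset.card_filter_add_card_filter_not (s := Finset.univ) fun i => -(s + e) ≤ α i
      have h4 := Finset.card_filter_add_card_filter_not (s := Finset.univ) fun i => -s ≤ β i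
      simp only [not_le] at h3 h4
      omega
    linarith

/-- Two decreasing lists are entrywise close if their counting functions are close on both sides,
away from zero. -/
theorem abs_sub_le_of_card_le {N : ℕ} {α β : Fin N → ℝ} (hα : Antitone α) (hβ : Antitone β)
    {T e : ℝ} (hT : 0 ≤ T)
    (hlo : ∀ s, T ≤ s → (Finset.univ.filter fun i => s ≤ β i).card
      ≤ (Finset.univ.filter fun i => s - e ≤ α i).card)
    (hup : ∀ s, T ≤ s → (Finset.univ.filter fun i => s + e < α i).card
      ≤ (Finset.univ.filter fun i => s < β i).card)
    (hlo' : ∀ s, T ≤ s → (Finset.univ.filter fun i => s ≤ -β i).card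
      ≤ (Finset.univ.filter fun i => s - e ≤ -α i).card)
    (hup' : ∀ s, T ≤ s → (Finset.univ.filter fun i => s + e < -α i).card
      ≤ (Finset.univ.filter fun i => s < -β i).card) (i : Fin N) :
    |α i - β i| ≤ e + 2 * T := by
  have hrev : ∀ {γ : Fin N → ℝ}, Antitone γ → Antitone fun i : Fin N => -γ i.rev := fun hγ i j hij =>
    neg_le_neg (hγ (Fin.rev_le_rev.2 hij))
  have h1 := antitone_ge_sub_of_card_le hα hβ hlo
    (fun s hs => by simpa only [lt_neg] using hup' s hs) hT i
  -- The upper bound on `α` is the lower bound for the negated, reversed lists.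
  have h2 := antitone_ge_sub_of_card_le (hrev hα) (hrev hβ)
    (fun s hs => by
      have ha := card_filter_comp_equiv (Fin.revPerm : Equiv.Perm (Fin N)) fun i => s ≤ -β i
      have hb := card_filter_comp_equiv (Fin.revPerm : Equiv.Perm (Fin N)) fun i => s - e ≤ -α i
      simp only [Fin.revPerm_apply] at ha hb
      rw [ha, hb]
      exact hlo' s hs)
    (fun s hs => by
      have ha := card_filter_comp_equiv (Fin.revPerm : Equiv.Perm (Fin N)) fun i => s < β i
      have hb := card_filter_comp_equiv (Fin.revPerm : Equiv.Perm (Fin N)) fun i => s + e < α i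
      simp only [Fin.revPerm_apply] at ha hb
      simp only [neg_lt_neg_iff]
      rw [ha, hb]
      exact hup s hs) hT i.rev
  simp only [Fin.rev_rev] at h2
  rw [abs_le]
  constructor <;> linarith

end Counting

/-! ### Courant–Fischer -/

section Spectral

variable {E ι : Type*} [NormedAddCommGroup E] [InnerProductSpace ℝ E] [Fintype ι]

/-- One half of the Courant–Fischer principle, as a bound on the number of small eigenvalues. -/
theorem finrank_add_card_lt_le (b : OrthonormalBasis ι ℝ E) (ev : ι → ℝ) {s : ℝ}
    (V : Submodule ℝ E) (hV : ∀ x ∈ V, s * ‖x‖ ^ 2 ≤ ∑ j, ev j * inner ℝ (b j) x ^ 2) :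
    Module.finrank ℝ V + (Finset.univ.filter fun j => ev j < s).card ≤ Fintype.card ι := by
  classical
  have : FiniteDimensional ℝ E := b.toBasis.finiteDimensional_of_finite
  have hE : Module.finrank ℝ E = Fintype.card ι := Module.finrank_eq_card_basis b.toBasis
  -- The kernel is the span of the basis vectors with `ev j < s`. On its nonzero vectors the form is
  -- strictly below `s * ‖x‖ ^ 2`, so it meets `V` trivially.
  let φ : E →ₗ[ℝ] ({j // ¬ ev j < s} → ℝ) := LinearMap.pi fun j => innerₛₗ ℝ (b j.1)
  have h1 := φ.finrank_range_add_finrank_ker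
  have h2 := (LinearMap.range φ).finrank_le
  rw [Module.finrank_fintype_fun_eq_card, Fintype.card_subtype] at h2
  have h3 := Finset.card_filter_add_card_filter_not (s := Finset.univ) fun j => ev j < s
  rw [Finset.card_univ] at h3
  have hdisj : Disjoint V (LinearMap.ker φ) := by
    rw [Submodule.disjoint_def]
    intro x hxV hxk
    have hz : ∀ j, ¬ ev j < s → inner ℝ (b j) x = 0 := fun j hj => by
      have := congrFun (LinearMap.mem_ker.1 hxk) ⟨j, hj⟩
      simpa [φ] using this
    have h4 := hV x hxV
    rw [← b.sum_sq_inner_right x, Finset.mul_sum] at h4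
    have h5 : ∀ j, ev j * inner ℝ (b j) x ^ 2 ≤ s * inner ℝ (b j) x ^ 2 := fun j => by
      by_cases hj : ev j < s
      · gcongr
      · rw [hz j hj]; simp
    have h6 : ∀ j, inner ℝ (b j) x = 0 := fun j => by
      by_cases hj : ev j < s
      · by_contra hne
        refine absurd h4 (not_le.2 (Finset.sum_lt_sum (fun j _ => h5 j) ⟨j, Finset.mem_univ _, ?_⟩))
        have : 0 < inner ℝ (b j) x ^ 2 := by positivity
        gcongr
      · exact hz j hj
    rw [← norm_eq_zero, ← sq_eq_zero_iff, ← b.sum_sq_inner_right x]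
    simp [h6]
  have h7 := Submodule.finrank_add_finrank_le_of_disjoint hdisj
  omega

variable {d k : ℕ} {D c F : ℝ} {a : Fin d → ℝ} {g : Fin d → E}

theorem IsGoodFamily.card_ge_le (h : IsGoodFamily k D c a g) (hk : k ≠ 0) (hD : 1 ≤ D)
    (ha : ∑ i, a i ^ 2 ≤ 1) (hanti : Antitone fun i => |a i|) (hF : 0 < F)
    (b : OrthonormalBasis ι ℝ E) (ev : ι → ℝ)
    (hq : ∀ x, ∑ j, ev j * inner ℝ (b j) x ^ 2 = F * ∑ i, a i * inner ℝ (g i) x ^ 2) {s : ℝ}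
    (hs : 8 * D * (1 + D) / √k ≤ s) :
    (Finset.univ.filter fun i => s ≤ a i).card ≤ (Finset.univ.filter fun j =>
      F * (s - (4 * D * (1 + D) + 4 * D ^ 2 + D) / √k + c) ≤ ev j).card := by
  obtain ⟨V, hV, hVq⟩ := h.exists_large_subspace_form_ge hk hD ha hanti hs
  have h1 := finrank_add_card_lt_le b ev
    (s := F * (s - (4 * D * (1 + D) + 4 * D ^ 2 + D) / √k + c)) V fun x hx => by
      rw [hq]
      have := mul_le_mul_of_nonneg_left (hVq x hx) hF.le
      linarith
  have h3 := Finset.card_filter_add_card_filter_not (s := Finset.univ) fun j =>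
    F * (s - (4 * D * (1 + D) + 4 * D ^ 2 + D) / √k + c) ≤ ev j
  simp only [not_le] at h3
  rw [Finset.card_univ] at h3
  omega

theorem IsGoodFamily.card_gt_le (h : IsGoodFamily k D c a g) (hk : k ≠ 0) (hD : 1 ≤ D)
    (ha : ∑ i, a i ^ 2 ≤ 1) (hanti : Antitone fun i => |a i|) (hF : 0 < F)
    (b : OrthonormalBasis ι ℝ E) (ev : ι → ℝ)
    (hq : ∀ x, ∑ j, ev j * inner ℝ (b j) x ^ 2 = F * ∑ i, a i * inner ℝ (g i) x ^ 2) {s : ℝ}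
    (hs : 8 * D * (1 + D) / √k ≤ s) :
    (Finset.univ.filter fun j =>
      F * (s + (4 * D * (1 + D) + 4 * D ^ 2 + D) / √k + c) < ev j).card
      ≤ (Finset.univ.filter fun i => s < a i).card := by
  have : FiniteDimensional ℝ E := b.toBasis.finiteDimensional_of_finite
  have hE : Module.finrank ℝ E = Fintype.card ι := Module.finrank_eq_card_basis b.toBasis
  obtain ⟨V, hV, hVq⟩ := h.exists_large_subspace_form_le hk hD ha hanti hs
  have h1 := finrank_add_card_lt_le b (fun j => -ev j)
    (s := -(F * (s + (4 * D * (1 + D) + 4 * D ^ 2 + D) / √k + c))) V fun x hx => by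
      simp only [neg_mul, Finset.sum_neg_distrib]
      rw [hq]
      have := mul_le_mul_of_nonneg_left (hVq x hx) hF.le
      linarith
  simp only [neg_lt_neg_iff] at h1
  omega

end Spectral

/-! ### Eigenbases of real symmetric matrices -/

section Matrices

theorem Matrix.IsSymm.isHermitian_real {n : ℕ} {M : Matrix (Fin n) (Fin n) ℝ} (hM : M.IsSymm) :
    M.IsHermitian := (Matrix.conjTranspose_eq_transpose_of_trivial M).trans hM

theorem exists_equiv_sortedEigenvalues {n : ℕ} {M : Matrix (Fin n) (Fin n) ℝ} (hM : M.IsSymm) :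
    ∃ τ : Fin n ≃ Fin n, ∀ i, sortedEigenvalues M hM (τ i) = hM.isHermitian_real.eigenvalues i :=
  ⟨(Fintype.equivOfCardEq (Fintype.card_fin _)).symm.trans
    (finCongr (Fintype.card_fin n)), fun i => by
      simp [sortedEigenvalues, Matrix.IsHermitian.eigenvalues]⟩

theorem EuclideanSpace.inner_eq_dotProduct {n : ℕ} (y z : EuclideanSpace ℝ (Fin n)) :
    inner ℝ y z = y.ofLp ⬝ᵥ z.ofLp := by
  simp [PiLp.inner_apply, dotProduct, mul_comm]

theorem dotProduct_mulVec_eq_sum_eigenvalues {n : ℕ} {M : Matrix (Fin n) (Fin n) ℝ}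
    (hM : M.IsHermitian) (x : EuclideanSpace ℝ (Fin n)) :
    x.ofLp ⬝ᵥ (M *ᵥ x.ofLp) = ∑ i, hM.eigenvalues i * inner ℝ (hM.eigenvectorBasis i) x ^ 2 := by
  have h1 := @EuclideanSpace.inner_eq_dotProduct n
  have h2 : x.ofLp ⬝ᵥ (M *ᵥ x.ofLp) = inner ℝ x (WithLp.toLp 2 (M *ᵥ x.ofLp)) := by rw [h1]
  rw [h2, ← hM.eigenvectorBasis.sum_inner_mul_inner x]
  refine Finset.sum_congr rfl fun i _ => ?_
  have h3 : inner ℝ (hM.eigenvectorBasis i) (WithLp.toLp 2 (M *ᵥ x.ofLp))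
      = hM.eigenvalues i * inner ℝ (hM.eigenvectorBasis i) x := by
    have hsymm : Mᵀ = M := by
      rw [← Matrix.conjTranspose_eq_transpose_of_trivial]; exact hM
    rw [h1, h1, Matrix.dotProduct_mulVec, ← Matrix.mulVec_transpose, hsymm,
      hM.mulVec_eigenvectorBasis, smul_dotProduct, smul_eq_mul]
  rw [h3, real_inner_comm]
  ring

theorem sum_sq_eigenvalues {n : ℕ} {M : Matrix (Fin n) (Fin n) ℝ} (hM : M.IsHermitian) :
    ∑ i, hM.eigenvalues i ^ 2 = ∑ i, ∑ j, M i j ^ 2 := by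
  have h1 : ∀ i, hM.eigenvalues i ^ 2
      = ∑ r, inner ℝ (hM.eigenvectorBasis i) (WithLp.toLp 2 (M r)) ^ 2 := by
    intro i
    have hn : ‖hM.eigenvalues i • hM.eigenvectorBasis i‖ ^ 2 = hM.eigenvalues i ^ 2 := by
      rw [norm_smul, hM.eigenvectorBasis.norm_eq_one, mul_one, Real.norm_eq_abs, sq_abs]
    rw [← hn, EuclideanSpace.real_norm_sq_eq]
    refine Finset.sum_congr rfl fun r _ => ?_
    have := congrFun (hM.mulVec_eigenvectorBasis i) r
    simp only [Pi.smul_apply] at this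
    rw [PiLp.smul_apply, ← this]
    simp [Matrix.mulVec, PiLp.inner_apply, dotProduct]
  simp_rw [h1]
  rw [Finset.sum_comm]
  refine Finset.sum_congr rfl fun r _ => ?_
  rw [hM.eigenvectorBasis.sum_sq_inner_right, EuclideanSpace.real_norm_sq_eq]

/-- An orthonormal eigenbasis ordered by decreasing modulus of the eigenvalue. -/
theorem exists_eigenbasis_abs_antitone {n : ℕ} {M : Matrix (Fin n) (Fin n) ℝ} (hM : M.IsSymm) :
    ∃ (l : Fin n → ℝ) (u : OrthonormalBasis (Fin n) ℝ (EuclideanSpace ℝ (Fin n))),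
      (Antitone fun i => |l i|) ∧
      (∃ τ : Fin n ≃ Fin n, ∀ i, sortedEigenvalues M hM (τ i) = l i) ∧
      (∀ x : EuclideanSpace ℝ (Fin n), x.ofLp ⬝ᵥ (M *ᵥ x.ofLp) = ∑ i, l i * inner ℝ (u i) x ^ 2) ∧
      ∑ i, l i ^ 2 = frobeniusNorm M ^ 2 := by
  have hH := hM.isHermitian_real
  let σ := Tuple.sort fun i => -|hH.eigenvalues i|
  obtain ⟨τ, hτ⟩ := exists_equiv_sortedEigenvalues hM
  refine ⟨hH.eigenvalues ∘ σ, hH.eigenvectorBasis.reindex σ.symm, fun i j hij => ?_,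
    ⟨σ.trans τ, fun i => hτ _⟩, fun x => ?_, ?_⟩
  · have := Tuple.monotone_sort (fun i => -|hH.eigenvalues i|) hij
    simpa [σ] using this
  · rw [dotProduct_mulVec_eq_sum_eigenvalues hH, ← Equiv.sum_comp σ]
    simp
  · rw [frobeniusNorm, Real.sq_sqrt (by positivity), ← sum_sq_eigenvalues hH,
      ← Equiv.sum_comp σ fun i => hH.eigenvalues i ^ 2]
    rfl

end Matrices

/-! ### Form and trace of the sketch in the eigenbasis -/

section SketchedFamily

/-- The images of an orthonormal basis under the sketch. -/
noncomputable def sketchedBasis {k d : ℕ}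
    (u : OrthonormalBasis (Fin d) ℝ (EuclideanSpace ℝ (Fin d))) (G : Matrix (Fin k) (Fin d) ℝ)
    (i : Fin d) : EuclideanSpace ℝ (Fin k) :=
  WithLp.toLp 2 (G *ᵥ (u i).ofLp)

variable {k d : ℕ} (u : OrthonormalBasis (Fin d) ℝ (EuclideanSpace ℝ (Fin d)))
  (G : Matrix (Fin k) (Fin d) ℝ)

theorem inner_sketchedBasis (i : Fin d) (x : EuclideanSpace ℝ (Fin k)) :
    inner ℝ (sketchedBasis u G i) x = inner ℝ (u i) (WithLp.toLp 2 (Gᵀ *ᵥ x.ofLp)) := by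
  rw [EuclideanSpace.inner_eq_dotProduct, EuclideanSpace.inner_eq_dotProduct, sketchedBasis,
    Matrix.dotProduct_mulVec, Matrix.vecMul_transpose]

variable {u} {A : Matrix (Fin d) (Fin d) ℝ} {l : Fin d → ℝ}

theorem sketch_form_eq (hq : ∀ x : EuclideanSpace ℝ (Fin d),
      x.ofLp ⬝ᵥ (A *ᵥ x.ofLp) = ∑ i, l i * inner ℝ (u i) x ^ 2) (x : EuclideanSpace ℝ (Fin k)) :
    x.ofLp ⬝ᵥ ((G * A * Gᵀ) *ᵥ x.ofLp) = ∑ i, l i * inner ℝ (sketchedBasis u G i) x ^ 2 := by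
  simp_rw [inner_sketchedBasis]
  rw [← hq, ← Matrix.mulVec_mulVec, ← Matrix.mulVec_mulVec, Matrix.dotProduct_mulVec,
    ← Matrix.mulVec_transpose]

theorem sketch_trace_eq (hq : ∀ x : EuclideanSpace ℝ (Fin d),
      x.ofLp ⬝ᵥ (A *ᵥ x.ofLp) = ∑ i, l i * inner ℝ (u i) x ^ 2) :
    (G * A * Gᵀ).trace = ∑ i, l i * ‖sketchedBasis u G i‖ ^ 2 := by
  have h : ∀ r, (G * A * Gᵀ) r r = ∑ i, l i * (sketchedBasis u G i) r ^ 2 := fun r => by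
    have := sketch_form_eq G hq (EuclideanSpace.single r 1)
    simpa [EuclideanSpace.inner_single_right] using this
  simp only [Matrix.trace, Matrix.diag_apply, h]
  rw [Finset.sum_comm]
  simp_rw [EuclideanSpace.real_norm_sq_eq, Finset.mul_sum]

end SketchedFamily

/-! ### The deterministic spectral estimate -/

section Closeness

/-- The subspace bounds are centred at `F * c`, which the algorithm does not know. Replacing it by
`t` adds `(D + 1) / √k` to the error, in units of `F`. -/
theorem IsGoodFamily.card_shifted {E ι : Type*} [NormedAddCommGroup E] [InnerProductSpace ℝ E]
    [Fintype ι] {d k : ℕ} {D c F t : ℝ} {a : Fin d → ℝ} {g : Fin d → E}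
    (h : IsGoodFamily k D c a g) (hk : k ≠ 0) (hD : 1 ≤ D)
    (ha : ∑ i, a i ^ 2 ≤ 1) (hanti : Antitone fun i => |a i|) (hF : 0 < F)
    (b : OrthonormalBasis ι ℝ E) (ev : ι → ℝ)
    (hq : ∀ x, ∑ j, ev j * inner ℝ (b j) x ^ 2 = F * ∑ i, a i * inner ℝ (g i) x ^ 2)
    (ht : |t - F * c| ≤ F * ((D + 1) / √k)) {s : ℝ} (hs : F * (8 * D * (1 + D) / √k) ≤ s) :
    (Finset.univ.filter fun i => s ≤ F * a i).card ≤ (Finset.univ.filter fun j =>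
        s - F * ((8 * D ^ 2 + 6 * D + 1) / √k) ≤ ev j - t).card ∧
      (Finset.univ.filter fun j => s + F * ((8 * D ^ 2 + 6 * D + 1) / √k) < ev j - t).card
        ≤ (Finset.univ.filter fun i => s < F * a i).card := by
  obtain ⟨r, rfl⟩ : ∃ r, s = F * r := ⟨s / F, by field_simp⟩
  have hr := le_of_mul_le_mul_left hs hF
  obtain ⟨ht1, ht2⟩ := abs_le.1 ht
  have he : F * ((8 * D ^ 2 + 6 * D + 1) / √k)
      = F * ((4 * D * (1 + D) + 4 * D ^ 2 + D) / √k) + F * ((D + 1) / √k) := by ring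
  constructor
  · have h1 := h.card_ge_le hk hD ha hanti hF b ev hq hr
    simp only [mul_le_mul_iff_right₀ hF]
    refine h1.trans (Finset.card_le_card fun j hj => ?_)
    simp only [Finset.mem_filter, Finset.mem_univ, true_and] at hj ⊢
    linarith
  · have h1 := h.card_gt_le hk hD ha hanti hF b ev hq hr
    simp only [mul_lt_mul_iff_right₀ hF]
    refine le_trans (Finset.card_le_card fun j hj => ?_) h1
    simp only [Finset.mem_filter, Finset.mem_univ, true_and] at hj ⊢
    linarith

theorem abs_spectrumAppx_sub_paddedSpectrum_le {k d N : ℕ} (hk : k ≠ 0) (hN : N = max k d)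
    {A : Matrix (Fin d) (Fin d) ℝ} (hA : A.IsSymm) (G : Matrix (Fin k) (Fin d) ℝ)
    {u : OrthonormalBasis (Fin d) ℝ (EuclideanSpace ℝ (Fin d))} {a : Fin d → ℝ} {F D c : ℝ}
    (hF : 0 < F) (hD : 1 ≤ D) (hanti : Antitone fun i => |a i|) (ha : ∑ i, a i ^ 2 ≤ 1)
    (hτ : ∃ τ : Fin d ≃ Fin d, ∀ i, sortedEigenvalues A hA (τ i) = F * a i)
    (hq : ∀ x : EuclideanSpace ℝ (Fin d),
      x.ofLp ⬝ᵥ (A *ᵥ x.ofLp) = ∑ i, F * a i * inner ℝ (u i) x ^ 2)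
    (hgood : IsGoodFamily k D c a (sketchedBasis u G))
    (htr : |(G * A * Gᵀ).trace / k - F * c| ≤ F * ((D + 1) / √k)) (i : Fin N) :
    |spectrumAppx N A hA G i - paddedSpectrum N A hA i|
      ≤ F * ((8 * D ^ 2 + 6 * D + 1) / √k) + 2 * (F * (8 * D * (1 + D) / √k)) := by
  have hk0 : (0 : ℝ) < k := by positivity
  have hsk : 0 < √(k : ℝ) := Real.sqrt_pos.2 hk0
  have hkN : k ≤ N := hN ▸ le_max_left _ _
  have hdN : d ≤ N := hN ▸ le_max_right _ _
  have hT : 0 < F * (8 * D * (1 + D) / √k) := by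
    have : 0 < D := by linarith
    positivity
  have he : 0 ≤ F * ((8 * D ^ 2 + 6 * D + 1) / √k) := by
    have : 0 < D := by linarith
    positivity
  obtain ⟨τ, hτ⟩ := hτ
  have hS := (sketch_isSymm hA G).isHermitian_real
  obtain ⟨ρ, hρ⟩ := exists_equiv_sortedEigenvalues (sketch_isSymm hA G)
  set ev := hS.eigenvalues with hev
  set t := (G * A * Gᵀ).trace / k with ht
  have hform : ∀ x, ∑ j, ev j * inner ℝ (hS.eigenvectorBasis j) x ^ 2
      = F * ∑ i, a i * inner ℝ (sketchedBasis u G i) x ^ 2 := fun x => by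
    rw [← dotProduct_mulVec_eq_sum_eigenvalues, sketch_form_eq G hq, Finset.mul_sum]
    exact Finset.sum_congr rfl fun i _ => mul_assoc _ _ _
  have hcardA : ∀ (p : ℝ → Prop) [DecidablePred p],
      (Finset.univ.filter fun i => p (sortedEigenvalues A hA i)).card
        = (Finset.univ.filter fun i => p (F * a i)).card := fun p _ => by
    rw [← card_filter_comp_equiv τ]
    simp only [hτ]
  have hcardS : ∀ (p : ℝ → Prop) [DecidablePred p],
      (Finset.univ.filter fun i => p (shiftedEigenvalues A hA G i)).card
        = (Finset.univ.filter fun i => p (ev i - t)).card := fun p _ => by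
    rw [← card_filter_comp_equiv ρ]
    simp only [shiftedEigenvalues, hρ, hev, ht]
  have hpos := fun {s : ℝ} (hs : F * (8 * D * (1 + D) / √k) ≤ s) =>
    hgood.card_shifted hk hD ha hanti hF hS.eigenvectorBasis ev hform htr hs
  have hneg := fun {s : ℝ} (hs : F * (8 * D * (1 + D) / √k) ≤ s) =>
    hgood.neg.card_shifted (F := F) (t := -t) (s := s) hk hD (by simpa using ha)
      (by simpa using hanti) hF hS.eigenvectorBasis (fun j => -ev j)
      (fun x => by simp [hform x]) (by
        rw [show -t - F * -c = -(t - F * c) by ring, abs_neg]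
        exact htr) hs
  refine abs_sub_le_of_card_le (sortDecreasing_antitone _) (sortDecreasing_antitone _) hT.le
    (fun s hs => ?_) (fun s hs => ?_) (fun s hs => ?_) (fun s hs => ?_) i
  · rw [card_filter_sortDecreasing _ fun y => s ≤ y, card_filter_sortDecreasing _ fun y => _ ≤ y]
    refine (card_filter_zeroPad_le hdN _ (fun y => s ≤ y) (by linarith)).trans
      (le_trans ?_ (card_filter_le_zeroPad hkN _ fun y => _ ≤ y))
    rw [hcardA fun y => s ≤ y, hcardS fun y => _ ≤ y]
    exact (hpos hs).1
  · rw [card_filter_sortDecreasing _ fun y => s < y, card_filter_sortDecreasing _ fun y => _ < y]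
    refine (card_filter_zeroPad_le hkN _ (fun y => _ < y) (by linarith)).trans
      (le_trans ?_ (card_filter_le_zeroPad hdN _ fun y => s < y))
    rw [hcardA fun y => s < y, hcardS fun y => _ < y]
    exact (hpos hs).2
  · rw [card_filter_sortDecreasing _ fun y => s ≤ -y, card_filter_sortDecreasing _ fun y => _ ≤ -y]
    refine (card_filter_zeroPad_le hdN _ (fun y => s ≤ -y) (by linarith)).trans
      (le_trans ?_ (card_filter_le_zeroPad hkN _ fun y => _ ≤ -y))
    rw [hcardA fun y => s ≤ -y, hcardS fun y => _ ≤ -y]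
    have := (hneg hs).1
    simpa only [Pi.neg_apply, mul_neg, neg_sub_neg, neg_sub] using this
  · rw [card_filter_sortDecreasing _ fun y => s < -y, card_filter_sortDecreasing _ fun y => _ < -y]
    refine (card_filter_zeroPad_le hkN _ (fun y => _ < -y) (by linarith)).trans
      (le_trans ?_ (card_filter_le_zeroPad hdN _ fun y => s < -y))
    rw [hcardA fun y => s < -y, hcardS fun y => _ < -y]
    have := (hneg hs).2
    simpa only [Pi.neg_apply, mul_neg, neg_sub_neg, neg_sub] using this

end Closeness

/-! ### Good families occur with high probability -/

section Probability

variable {k d : ℕ} (u : OrthonormalBasis (Fin d) ℝ (EuclideanSpace ℝ (Fin d)))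

theorem sum_orthonormalBasis_mul (i j : Fin d) :
    ∑ r, u i r * u j r = if i = j then 1 else 0 := by
  have := orthonormal_iff_ite.1 u.orthonormal i j
  rw [EuclideanSpace.inner_eq_dotProduct] at this
  exact this

/-- The vectors `G uᵢ`, `i < n`, are nearly orthonormal with high probability. -/
theorem measureReal_not_nearlyOrthonormal_le (hk : k ≠ 0) {n : ℕ} (hn : n ≤ k) (c : ℝ) :
    (gaussianSketch k d).real {G | ¬ NearlyOrthonormal (sketchedBasis u (Matrix.of G)) n
      (32 * c * (√n / √k))} ≤ 5 ^ n * (2 * Real.exp ((1 / 8 - c / 4) * n)) := by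
  classical
  have hk0 : (0 : ℝ) < k := by positivity
  have hsk : 0 < √(k : ℝ) := Real.sqrt_pos.2 hk0
  let I : Finset (Fin d) := Finset.univ.filter fun i => i.val < n
  let E : Submodule ℝ (EuclideanSpace ℝ (Fin d)) := Submodule.span ℝ (I.image u)
  have hE : Module.finrank ℝ E ≤ n := by
    refine (finrank_span_finset_le_card _).trans (Finset.card_image_le.trans ?_)
    rw [Fin.card_filter_val_lt]
    exact min_le_right _ _
  -- The functional of index `r` is the coordinate `(G v) r`. All `k` weights are 1, so `V = √k`,
  -- and the net lives in a span of dimension at most `n`.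
  let w : Fin k → E →ₗ[ℝ] (Fin k × Fin d → ℝ) := fun r =>
    { toFun := fun v p => if r = p.1 then (v : EuclideanSpace ℝ (Fin d)) p.2 else 0
      map_add' := fun v v' => by ext p; by_cases h : r = p.1 <;> simp [h]
      map_smul' := fun q v => by ext p; by_cases h : r = p.1 <;> simp [h] }
  have hw : ∀ v i j, ∑ p, w i v p * w j v p = if i = j then ‖v‖ ^ 2 else 0 := by
    intro v i j
    rw [Fintype.sum_prod_type]
    simp only [w, LinearMap.coe_mk, AddHom.coe_mk, ite_mul, zero_mul, mul_ite, mul_zero]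
    by_cases hij : i = j
    · subst hij
      rw [Finset.sum_eq_single i (fun r _ hr => by simp [hr.symm]) (by simp), if_pos rfl,
        Submodule.coe_norm, EuclideanSpace.real_norm_sq_eq]
      simp [sq]
    · rw [if_neg hij]
      refine Finset.sum_eq_zero fun r _ => Finset.sum_eq_zero fun _ _ => ?_
      by_cases h1 : i = r
      · subst h1; simp [Ne.symm hij]
      · simp [h1]
  refine le_trans (measureReal_mono ?_ (measure_ne_top _ _))
    (measureReal_sketch_form_deviation_le hk hE w hw (fun _ => 1) hsk (by simp) (fun i => by
      rw [abs_one, one_mul]; gcongr) c)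
  intro G hG hall
  refine hG fun y => ?_
  have hv : (∑ i ∈ I, y i • u i) ∈ E := Submodule.sum_mem _ fun i hi =>
    Submodule.smul_mem _ _ (Submodule.subset_span (by simpa using ⟨i, hi, rfl⟩))
  have h1 := hall ⟨_, hv⟩
  have hnorm : ‖∑ i ∈ I, y i • u i‖ ^ 2 = ∑ i with i.val < n, y i ^ 2 := by
    rw [← real_inner_self_eq_norm_sq, u.orthonormal.inner_sum]
    simp [I, sq]
  have hcomb : ∀ r, ∑ p, w r ⟨_, hv⟩ p * G p.1 p.2
      = initialCombination (sketchedBasis u (Matrix.of G)) n y r := by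
    intro r
    rw [Fintype.sum_prod_type, Finset.sum_eq_single r (fun r' _ hr => by simp [w, hr.symm])
      (by simp), initialCombination_apply]
    simp only [w, LinearMap.coe_mk, AddHom.coe_mk, if_true, I, WithLp.ofLp_sum, WithLp.ofLp_smul,
      Finset.sum_apply, Pi.smul_apply, smul_eq_mul, sketchedBasis, Matrix.mulVec, dotProduct,
      Matrix.of_apply, Finset.sum_mul, Finset.mul_sum]
    rw [Finset.sum_comm]
    exact Finset.sum_congr rfl fun i _ => Finset.sum_congr rfl fun j _ => by ring
  have hsum : ∑ r, (1 : ℝ) * ((∑ p, w r ⟨_, hv⟩ p * G p.1 p.2) ^ 2 - ‖(⟨_, hv⟩ : E)‖ ^ 2 / k)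
      = ‖initialCombination (sketchedBasis u (Matrix.of G)) n y‖ ^ 2
        - ∑ i with i.val < n, y i ^ 2 := by
    simp only [one_mul, hcomb, Finset.sum_sub_distrib, Submodule.coe_norm, hnorm]
    rw [EuclideanSpace.real_norm_sq_eq]
    simp only [Finset.sum_const, Finset.card_univ, Fintype.card_fin, nsmul_eq_mul]
    rw [mul_div_cancel₀ _ hk0.ne']
  rw [hsum, Submodule.coe_norm, hnorm] at h1
  refine h1.trans (le_of_eq ?_)
  congr 1
  nth_rewrite 2 [← Real.mul_self_sqrt hk0.le]
  field_simp

/-- The part of the sketch with small weights is nearly a multiple of the identity with high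
probability. -/
theorem measureReal_small_weights_deviation_le (hk : k ≠ 0) (b : Fin d → ℝ)
    (hb2 : ∑ i, b i ^ 2 ≤ 1) (hb : ∀ i, |b i| ≤ 1 / √k) (c : ℝ) :
    (gaussianSketch k d).real {G | ¬ ∀ x : EuclideanSpace ℝ (Fin k),
      |∑ i, b i * inner ℝ (sketchedBasis u (Matrix.of G) i) x ^ 2 - (∑ i, b i) / k * ‖x‖ ^ 2|
        ≤ 32 * c / √k * ‖x‖ ^ 2} ≤ 5 ^ k * (2 * Real.exp ((1 / 8 - c / 4) * k)) := by
  have hk0 : (0 : ℝ) < k := by positivity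
  have hsk : 0 < √(k : ℝ) := Real.sqrt_pos.2 hk0
  -- Here the functionals are `⟪G (u i), x⟫` and `x` ranges over all of `ℝᵏ`. With `V = 1`, the
  -- requirement `|b i| * √k ≤ V` is exactly smallness of the weights; this dictates the cut-off `1
  -- / √k`.
  let w : Fin d → EuclideanSpace ℝ (Fin k) →ₗ[ℝ] (Fin k × Fin d → ℝ) := fun i =>
    { toFun := fun x p => x p.1 * u i p.2
      map_add' := fun x y => by ext p; simp [add_mul]
      map_smul' := fun q x => by ext p; simp [mul_assoc] }
  have hw : ∀ x i j, ∑ p, w i x p * w j x p = if i = j then ‖x‖ ^ 2 else 0 := by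
    intro x i j
    have h1 : ∑ p, w i x p * w j x p = (∑ r, x r ^ 2) * ∑ q, u i q * u j q := by
      rw [Fintype.sum_prod_type, Finset.sum_mul_sum]
      exact Finset.sum_congr rfl fun r _ => Finset.sum_congr rfl fun q _ => by
        simp only [w, LinearMap.coe_mk, AddHom.coe_mk]; ring
    rw [h1, sum_orthonormalBasis_mul, EuclideanSpace.real_norm_sq_eq]
    simp
  refine le_trans (measureReal_mono ?_ (measure_ne_top _ _))
    (measureReal_sketch_form_deviation_le hk (n := k) (by simp) w hw b one_pos (by simpa using hb2)
      (fun i => by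
        have := hb i
        rwa [le_div_iff₀ hsk] at this) c)
  intro G hG hall
  refine hG fun x => ?_
  have h1 := hall x
  have h2 : ∀ i, ∑ p, w i x p * G p.1 p.2 = inner ℝ (sketchedBasis u (Matrix.of G) i) x := by
    intro i
    rw [EuclideanSpace.inner_eq_dotProduct, Fintype.sum_prod_type]
    simp only [w, LinearMap.coe_mk, AddHom.coe_mk, sketchedBasis, dotProduct, Matrix.mulVec,
      Matrix.of_apply, Finset.sum_mul]
    exact Finset.sum_congr rfl fun r _ => Finset.sum_congr rfl fun q _ => by ring
  simp only [h2, mul_sub, Finset.sum_sub_distrib, ← Finset.sum_mul] at h1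
  rw [show (∑ i, b i) * (‖x‖ ^ 2 / k) = (∑ i, b i) / k * ‖x‖ ^ 2 by ring] at h1
  refine h1.trans (le_of_eq ?_)
  congr 1
  nth_rewrite 2 [← Real.mul_self_sqrt hk0.le]
  field_simp

/-- The `k * d` coordinates of the vectors `G (u i)` are independent `N(0, 1 / k)`, and each weight
occurs `k` times, so `V = √k`. No net is needed, hence `m = 1`. -/
theorem measureReal_trace_deviation_le (hk : k ≠ 0) (a : Fin d → ℝ) (ha : ∑ i, a i ^ 2 ≤ 1)
    (c : ℝ) :
    (gaussianSketch k d).real {G | c / √k ≤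
      |∑ i, a i * ‖sketchedBasis u (Matrix.of G) i‖ ^ 2 - ∑ i, a i|}
        ≤ 2 * Real.exp (1 / 8 - c / 4) := by
  have hk0 : (0 : ℝ) < k := by positivity
  have hsk : 0 < √(k : ℝ) := Real.sqrt_pos.2 hk0
  have hsk1 : 1 ≤ √(k : ℝ) := by
    rw [Real.one_le_sqrt]; exact_mod_cast Nat.one_le_iff_ne_zero.2 hk
  let w : Fin k × Fin d → Fin k × Fin d → ℝ := fun q p => if q.1 = p.1 then u q.2 p.2 else 0
  have hw : ∀ q q', ∑ p, w q p * w q' p = if q = q' then 1 else 0 := by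
    intro q q'
    rw [Fintype.sum_prod_type]
    simp only [w, ite_mul, zero_mul, mul_ite, mul_zero]
    rw [Finset.sum_eq_single q.1 (fun r _ hr => by simp [hr.symm]) (by simp)]
    by_cases h1 : q'.1 = q.1
    · simp only [h1, if_true]
      rw [sum_orthonormalBasis_mul]
      simp [Prod.ext_iff, h1]
    · simp [Prod.ext_iff, h1, Ne.symm h1]
  obtain ⟨hind, hlaw⟩ := orthonormal_functionals_gaussianSketch w hw
  have h := measureReal_abs_sum_centered_sq_ge_le_of_weights (by simpa using hk)
    (fun i => by fun_prop) hind hlaw (fun q => a q.2) hsk zero_le_one (by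
      rw [Fintype.sum_prod_type, Real.sq_sqrt hk0.le]
      simp only [Finset.sum_const, Finset.card_univ, Fintype.card_fin, nsmul_eq_mul]
      nlinarith) (fun q => by
      rw [Real.sqrt_one, mul_one]
      refine le_trans ?_ hsk1
      rw [← sq_le_one_iff_abs_le_one]
      exact (Finset.single_le_sum (fun i _ => sq_nonneg (a i)) (Finset.mem_univ q.2)).trans ha) c
  rw [mul_one] at h
  convert! h using 3
  ext G
  have h1 : ∀ q, ∑ p, w q p * G p.1 p.2 = sketchedBasis u (Matrix.of G) q.2 q.1 := by
    intro q
    rw [Fintype.sum_prod_type, Finset.sum_eq_single q.1 (fun r _ hr => by simp [w, hr.symm])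
      (by simp)]
    simp only [w, if_true, sketchedBasis, dotProduct, Matrix.mulVec, Matrix.of_apply]
    exact Finset.sum_congr rfl fun j _ => mul_comm _ _
  have h2 : ∑ q : Fin k × Fin d, a q.2 * ((∑ p, w q p * G p.1 p.2) ^ 2 - ((k : ℝ≥0)⁻¹ : ℝ≥0))
      = ∑ i, a i * ‖sketchedBasis u (Matrix.of G) i‖ ^ 2 - ∑ i, a i := by
    simp only [h1]
    rw [Fintype.sum_prod_type_right, ← Finset.sum_sub_distrib]
    refine Finset.sum_congr rfl fun i _ => ?_
    dsimp only
    rw [← Finset.mul_sum, Finset.sum_sub_distrib, ← EuclideanSpace.real_norm_sq_eq]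
    simp [hk, mul_sub]
  have h3 : c / √k = c * √k * √1 * ((k : ℝ≥0)⁻¹ : ℝ≥0) := by
    rw [Real.sqrt_one, mul_one]
    simp only [NNReal.coe_inv, NNReal.coe_natCast]
    nth_rewrite 3 [← Real.mul_self_sqrt hk0.le]
    field_simp
  rw [h2, h3]

end Probability

/-- The choice `c = 24` gives a decay rate beating the net size `5 ^ n`, with a summable remainder.
After the net factor 32, it is the source of `768 = 32 * 24`. -/
theorem five_pow_mul_exp_le (n : ℕ) :
    (5 : ℝ) ^ n * (2 * Real.exp ((1 / 8 - 24 / 4) * n)) ≤ 2 * (1 / 20) ^ n := by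
  have h1 : Real.exp (1 / 8 - 24 / 4) ≤ 1 / 100 := by
    have h2 : Real.exp (1 / 8 - 24 / 4) ≤ Real.exp (-5) := Real.exp_le_exp.2 (by norm_num)
    have h3 : (100 : ℝ) ≤ Real.exp 5 := by
      have h4 : Real.exp 5 = Real.exp 1 ^ 5 := by rw [← Real.exp_nat_mul]; norm_num
      have h5 : (2.7 : ℝ) ≤ Real.exp 1 := by linarith [Real.exp_one_gt_d9]
      rw [h4]
      refine le_trans ?_ (pow_le_pow_left₀ (by norm_num) h5 5)
      norm_num
    refine h2.trans ?_
    rw [Real.exp_neg, inv_eq_one_div]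
    gcongr
  rw [mul_comm _ (n : ℝ), Real.exp_nat_mul]
  calc (5 : ℝ) ^ n * (2 * Real.exp (1 / 8 - 24 / 4) ^ n)
      = 2 * (5 * Real.exp (1 / 8 - 24 / 4)) ^ n := by rw [mul_pow]; ring
    _ ≤ 2 * (1 / 20) ^ n := by gcongr; linarith

theorem sum_pow_succ_le (k : ℕ) : ∑ m ∈ Finset.range k, 2 * (1 / 20 : ℝ) ^ (m + 1) ≤ 2 / 19 := by
  have h : ∀ k : ℕ, ∑ m ∈ Finset.range k, 2 * (1 / 20 : ℝ) ^ (m + 1)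
      = 2 / 19 * (1 - (1 / 20) ^ k) := by
    intro k
    induction k with
    | zero => simp
    | succ k ih => rw [Finset.sum_range_succ, ih]; ring
  rw [h]
  have : (0 : ℝ) ≤ (1 / 20) ^ k := by positivity
  linarith

/-- With probability at least `3/5` the sketched eigenbasis is a good family and the trace of the
sketch is concentrated. -/
theorem measureReal_good_ge {k d : ℕ} (hk : k ≠ 0)
    (u : OrthonormalBasis (Fin d) ℝ (EuclideanSpace ℝ (Fin d))) (a : Fin d → ℝ)
    (ha : ∑ i, a i ^ 2 ≤ 1) :
    3 / 5 ≤ (gaussianSketch k d).real {G |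
      IsGoodFamily k 768 ((∑ i, if 1 / √k ≤ |a i| then 0 else a i) / k) a
        (sketchedBasis u (Matrix.of G)) ∧
      |∑ i, a i * ‖sketchedBasis u (Matrix.of G) i‖ ^ 2 - ∑ i, a i| ≤ 768 / √k} := by
  set P := gaussianSketch k d with hP
  set b : Fin d → ℝ := fun i => if 1 / √k ≤ |a i| then 0 else a i with hb
  set good := {G : Fin k → Fin d → ℝ | IsGoodFamily k 768 ((∑ i, b i) / k) a
        (sketchedBasis u (Matrix.of G)) ∧
      |∑ i, a i * ‖sketchedBasis u (Matrix.of G) i‖ ^ 2 - ∑ i, a i| ≤ 768 / √k} with hgood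
  let gramBad : ℕ → Set (Fin k → Fin d → ℝ) := fun n =>
    {G | ¬ NearlyOrthonormal (sketchedBasis u (Matrix.of G)) n (32 * 24 * (√n / √k))}
  let tailBad : Set (Fin k → Fin d → ℝ) := {G | ¬ ∀ x : EuclideanSpace ℝ (Fin k),
      |∑ i, b i * inner ℝ (sketchedBasis u (Matrix.of G) i) x ^ 2 - (∑ i, b i) / k * ‖x‖ ^ 2|
        ≤ 32 * 24 / √k * ‖x‖ ^ 2}
  let traceBad : Set (Fin k → Fin d → ℝ) := {G | 24 / √k ≤
      |∑ i, a i * ‖sketchedBasis u (Matrix.of G) i‖ ^ 2 - ∑ i, a i|}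
  have hcover : (Set.univ : Set (Fin k → Fin d → ℝ)) ⊆
      good ∪ ((⋃ m ∈ Finset.range k, gramBad (m + 1)) ∪ (tailBad ∪ traceBad)) := by
    intro G _
    by_contra hcon
    simp only [Set.mem_union, not_or] at hcon
    obtain ⟨hG, hgram, htail, htrace⟩ := hcon
    refine hG ⟨⟨fun n hn => ?_, fun x => ?_⟩, ?_⟩
    -- Length 0 holds trivially and is kept out of the union bound, where its estimate `2 * (1 / 20)
    -- ^ 0` would be useless.
    · rcases Nat.eq_zero_or_pos n with rfl | hpos
      · intro y
        simp [initialCombination_apply]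
      · by_contra hbad
        refine hgram (Set.mem_biUnion (x := n - 1) (by
          simp only [Finset.coe_range, Set.mem_Iio]; omega) ?_)
        rw [Nat.sub_add_cancel hpos]
        simpa only [gramBad, Set.mem_ofPred_eq, show (32 * 24 : ℝ) = 768 by norm_num] using hbad
    · have h1 := not_not.1 htail x
      rwa [show (32 * 24 : ℝ) = 768 by norm_num] at h1
    · refine (not_le.1 htrace).le.trans ?_
      gcongr
      norm_num
  have hb2 : ∑ i, b i ^ 2 ≤ 1 := le_trans (Finset.sum_le_sum fun i _ => by
    simp only [hb]; split_ifs
    · simpa using sq_nonneg (a i)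
    · exact le_rfl) ha
  have hb1 : ∀ i, |b i| ≤ 1 / √k := fun i => by
    simp only [hb]; split_ifs with h
    · simp
    · exact (not_le.1 h).le
  have hgram : P.real (⋃ m ∈ Finset.range k, gramBad (m + 1)) ≤ 2 / 19 := by
    refine (measureReal_biUnion_finset_le _ _).trans (le_trans (Finset.sum_le_sum fun m hm => ?_)
      (sum_pow_succ_le k))
    exact (measureReal_not_nearlyOrthonormal_le u hk
      (by have := Finset.mem_range.1 hm; omega) 24).trans (five_pow_mul_exp_le (m + 1))
  have htail : P.real tailBad ≤ 2 * (1 / 20) ^ 1 := by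
    refine (measureReal_small_weights_deviation_le u hk b hb2 hb1 24).trans
      ((five_pow_mul_exp_le k).trans ?_)
    exact mul_le_mul_of_nonneg_left (pow_le_pow_of_le_one (by norm_num) (by norm_num)
      (Nat.one_le_iff_ne_zero.2 hk)) (by norm_num)
  have htrace : P.real traceBad ≤ 2 * (1 / 20) ^ 1 := by
    refine (measureReal_trace_deviation_le u hk a ha 24).trans ?_
    have := five_pow_mul_exp_le 1
    simp only [Nat.cast_one, mul_one, pow_one] at this ⊢
    linarith [Real.exp_pos (1 / 8 - 24 / 4)]
  have h1 := measureReal_mono (μ := P) hcover (measure_ne_top _ _)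
  rw [probReal_univ] at h1
  have h2 := measureReal_union_le (μ := P) good
    ((⋃ m ∈ Finset.range k, gramBad (m + 1)) ∪ (tailBad ∪ traceBad))
  have h3 := measureReal_union_le (μ := P) (⋃ m ∈ Finset.range k, gramBad (m + 1))
    (tailBad ∪ traceBad)
  have h4 := measureReal_union_le (μ := P) tailBad traceBad
  -- The failure probabilities total at most `2 / 19 + 1 / 10 + 1 / 10 < 2 / 5`.
  norm_num at htail htrace
  linarith

theorem frobeniusNorm_pos {d : ℕ} {A : Matrix (Fin d) (Fin d) ℝ} (hA : A ≠ 0) :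
    0 < frobeniusNorm A := by
  obtain ⟨i, j, hij⟩ : ∃ i j, A i j ≠ 0 := by
    by_contra! h
    exact hA (Matrix.ext h)
  refine Real.sqrt_pos.2 (Finset.sum_pos' (fun _ _ => Finset.sum_nonneg fun _ _ => sq_nonneg _)
    ⟨i, Finset.mem_univ _, Finset.sum_pos' (fun _ _ => sq_nonneg _) ⟨j, Finset.mem_univ _, ?_⟩⟩)
  positivity

/-- The trace concentrates around the sum of all weights, whereas `c` involves only the small ones.
The large weights sum to at most `√k` in modulus, which contributes `1 / √k` after division by `k`.
-/
theorem abs_trace_sketch_sub_le {k d : ℕ} (hk : k ≠ 0) {a n2 : Fin d → ℝ} {D : ℝ}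
    (ha : ∑ i, a i ^ 2 ≤ 1) (h : |∑ i, a i * n2 i - ∑ i, a i| ≤ D / √k) :
    |(∑ i, a i * n2 i) / k - (∑ i, if 1 / √k ≤ |a i| then 0 else a i) / k| ≤ (D + 1) / √k := by
  have hk0 : (0 : ℝ) < k := by positivity
  have hk1 : (1 : ℝ) ≤ k := by exact_mod_cast Nat.one_le_iff_ne_zero.2 hk
  have hsk : 0 < √(k : ℝ) := Real.sqrt_pos.2 hk0
  have hhead : |∑ i, (if 1 / √k ≤ |a i| then a i else 0)| ≤ √k := by
    calc |∑ i, (if 1 / √k ≤ |a i| then a i else 0)|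
        ≤ ∑ i, |if 1 / √k ≤ |a i| then a i else 0| := Finset.abs_sum_le_sum_abs _ _
      _ ≤ ∑ i, √k * a i ^ 2 := Finset.sum_le_sum fun i _ => by
          split_ifs with h1
          · rw [div_le_iff₀ hsk] at h1
            rw [← sq_abs]
            nlinarith [abs_nonneg (a i)]
          · rw [abs_zero]; positivity
      _ = √k * ∑ i, a i ^ 2 := by rw [Finset.mul_sum]
      _ ≤ √k * 1 := by gcongr
      _ = √k := mul_one _
  have hsplit : ∑ i, a i = ∑ i, (if 1 / √k ≤ |a i| then a i else 0)
      + ∑ i, if 1 / √k ≤ |a i| then 0 else a i := by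
    rw [← Finset.sum_add_distrib]
    exact Finset.sum_congr rfl fun i _ => by split_ifs <;> simp
  rw [← sub_div, abs_div, abs_of_pos hk0, div_le_iff₀ hk0]
  have h1 : ∑ i, a i * n2 i - (∑ i, if 1 / √k ≤ |a i| then 0 else a i)
      = (∑ i, a i * n2 i - ∑ i, a i) + ∑ i, (if 1 / √k ≤ |a i| then a i else 0) := by
    rw [hsplit]; ring
  rw [h1]
  have hD : 0 ≤ D / √k := (abs_nonneg _).trans h
  calc _ ≤ D / √k + √k := (abs_add_le _ _).trans (add_le_add h hhead)
    _ ≤ D / √k * k + √k := by nlinarith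
    _ = D / √k * k + k / √k := by rw [Real.div_sqrt]
    _ = (D + 1) / √k * k := by ring

theorem mainTheorem1 :
    ∃ C : ℝ, 0 < C ∧
      ∀ (ε : ℝ), 0 < ε → ∀ (d k N : ℕ), C / ε ^ 2 ≤ (k : ℝ) → N = max k d →
        ∀ (A : Matrix (Fin d) (Fin d) ℝ) (hA : A.IsSymm), A ≠ 0 →
          (3 / 5 : ℝ≥0∞) ≤ gaussianSketch k d
            {G | ∀ i : Fin N,
              |spectrumAppx N A hA (Matrix.of G) i - paddedSpectrum N A hA i| < ε * frobeniusNorm A} := by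
  -- `K` is the total error constant of `abs_spectrumAppx_sub_paddedSpectrum_le` at `D = 768`; using
  -- `K + 1` below makes the final inequality strict.
  obtain ⟨K, hK⟩ : ∃ K : ℝ, K = 8 * 768 ^ 2 + 6 * 768 + 1 + 16 * 768 * (1 + 768) := ⟨_, rfl⟩
  have hK0 : 0 < K := by rw [hK]; norm_num
  refine ⟨(K + 1) ^ 2, by positivity, fun ε hε d k N hkε hN A hA hA0 => ?_⟩
  have hk0 : (0 : ℝ) < k := lt_of_lt_of_le (by positivity) hkε
  have hk : k ≠ 0 := by rintro rfl; simp at hk0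
  have hsk : 0 < √(k : ℝ) := Real.sqrt_pos.2 hk0
  have hKε : K / √k < ε := by
    rw [div_le_iff₀ (by positivity)] at hkε
    have h1 : K + 1 ≤ √k * ε := by
      refine abs_le_of_sq_le_sq' ?_ (by positivity) |>.2
      rwa [mul_pow, Real.sq_sqrt hk0.le]
    rw [div_lt_iff₀ hsk]
    linarith
  obtain ⟨l, u, hanti, ⟨τ, hτ⟩, hq, hsum⟩ := exists_eigenbasis_abs_antitone hA
  have hF := frobeniusNorm_pos hA0
  set F := frobeniusNorm A with hFdef
  let a : Fin d → ℝ := fun i => l i / F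
  have hl : ∀ i, l i = F * a i := fun i => by simp only [a]; field_simp
  have ha : ∑ i, a i ^ 2 ≤ 1 := by
    simp only [a, div_pow, ← Finset.sum_div, hsum]
    rw [div_self (by positivity)]
  have haanti : Antitone fun i => |a i| := fun i j hij => by
    simp only [a, abs_div]
    exact div_le_div_of_nonneg_right (hanti hij) (abs_nonneg F)
  simp only [hl] at hτ hq
  have hprob := measureReal_good_ge hk u a ha
  have hmono := hprob.trans (measureReal_mono (μ := gaussianSketch k d) (fun G hG => ?_)
    (measure_ne_top _ {G | ∀ i : Fin N,
      |spectrumAppx N A hA (Matrix.of G) i - paddedSpectrum N A hA i| < ε * F}))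
  · have h1 := ENNReal.ofReal_le_ofReal hmono
    rw [measureReal_def, ENNReal.ofReal_toReal (measure_ne_top _ _)] at h1
    refine le_trans (le_of_eq ?_) h1
    rw [ENNReal.ofReal_div_of_pos (by norm_num)]
    norm_num
  · obtain ⟨hgood, htr⟩ := hG
    intro i
    refine lt_of_le_of_lt (abs_spectrumAppx_sub_paddedSpectrum_le hk hN hA (Matrix.of G) hF
      (by norm_num) haanti ha ⟨τ, hτ⟩ hq hgood ?_ i) ?_
    · rw [sketch_trace_eq (Matrix.of G) hq]
      simp only [mul_assoc, ← Finset.mul_sum]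
      rw [mul_div_assoc, ← mul_sub, abs_mul, abs_of_pos hF]
      exact mul_le_mul_of_nonneg_left (abs_trace_sketch_sub_le hk ha htr) hF.le
    · calc _ = F * (K / √k) := by rw [hK]; ring
        _ < F * ε := by gcongr
        _ = ε * F := mul_comm _ _
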